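/- **Setting.** Let $Q$ be a smooth $n$-manifold, $(E,[\![\cdot,\cdot]\!]_E,\rho)$ a Lie algebroid over $Q$, $\mathcal G$ a nondegenerate bundle metric on $E$, $V\in C^\infty(Q)$, and $\mathcal D\subset E$ a vector subbundle with $E=\mathcal D\oplus\mathcal D^\perp$ and orthogonal projector $\mathcal P:E\to\mathcal D$. Let $\mathcal D_{(c)}\subset\mathcal D$ be a control subbundle of rank $k<\operatorname{rank}\mathcal D$. Fix a chart $(q^i)$ of $Q$ and sections $\{e_A\}=\{e_a,e_\alpha\}$ of $\mathcal D$ which over the chart domain form a basis of $\mathcal D$ with $\mathcal D_{(c)}=\operatorname{span}\{e_a\}$; write $y^A$ for the induced fibre coordinates, $\rho(e_A)=\rho^i_A\,\partial/\partial q^i$, $\mathcal G_{AB}=\mathcal G(e_A,e_B)$ with inverse $\mathcal G^{AB}$, and $\nabla_{e_A}e_B=\Gamma^C_{AB}e_C$, where $\nabla$ is the Levi-Civita connection on $\mathcal D$ given by the Koszul formula for $\mathcal G|_{\mathcal D}$ and the bracket $\mathcal P[\![\cdot,\cdot]\!]_E$. Set $$F^C(q,y,\dot y)=\dot y^C+\Gamma^C_{AB}y^Ay^B+\mathcal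 G^{CB}\rho^i_B\frac{\partial V}{\partial q^i},\qquad \Phi^\alpha=F^\alpha .$$ A *solution* on $[0,T]$, $T>0$, is a triple $(q,y,u)$ with $(q,y)$ of class $C^N$ ($1\le N\le\infty$) in the chart domain, $u$ valued in an open set $\mathcal U\subset\mathbb R^k$, such that $\gamma=y^Ae_A$ is admissible, $\dot q^i=\rho^i_Ay^A$, and $\nabla_\gamma\gamma+\operatorname{grad}V=u^ae_a$, i.e. $F^a=u^a$ and $\Phi^\alpha=0$. Let $C:\mathcal D\times\mathcal U\to\mathbb R$ be a smooth cost and $\mathcal J=\int_0^TC(\gamma,u)\,dt$. Put $\mathcal L(q,y,\dot y)=C\big(q,y,(F^a(q,y,\dot y))_a\big)$ and $$\widetilde{\mathcal L}=\mathcal L+\lambda_i(\dot q^i-\rho^i_Ay^A)+\bar\lambda_\alpha\Phi^\alpha .$$ Consider on $[0,T]$, for $C^1$ multipliers $\lambda_i,\bar\lambda_\alpha$, the system $$\begin{aligned} 0&=\dot\lambda_i+\lambda_j\frac{\partial\rho^j_A}{\partial q^i}y^A-\frac{\partial\mathcal L}{\partial q^i}-\bar\lambda_\alpha\frac{\partial\Phi^\alpha}{\partial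 q^i},\\ 0&=\frac{d}{dt}\Big(\frac{\partial\mathcal L}{\partial\dot y^a}\Big)+\rho^i_a\lambda_i-\frac{\partial\mathcal L}{\partial y^a}-\bar\lambda_\alpha(\Gamma^\alpha_{aB}+\Gamma^\alpha_{Ba})y^B,\\ 0&=\dot{\bar\lambda}_\alpha+\frac{d}{dt}\Big(\frac{\partial\mathcal L}{\partial\dot y^\alpha}\Big)+\lambda_i\rho^i_\alpha-\frac{\partial\mathcal L}{\partial y^\alpha}-\bar\lambda_\beta(\Gamma^\beta_{\alpha B}+\Gamma^\beta_{B\alpha})y^B,\\ 0&=\dot q^i-\rho^i_Ay^A,\qquad 0=\Phi^\alpha . \end{aligned}\tag{$*$}$$ A curve $(q,y)$ is *abnormal* if $(*)$ with $\mathcal L$ replaced by $0$ holds for some $(\lambda,\bar\lambda)\not\equiv0$. **Theorem.** (1) Let $(q,y,u)$ be a solution that minimizes, or maximizes, $\mathcal J$ among all solutions of class $C^N$ with the same values of $(q,y)$ at $0$ and $T$ that are uniformly $\varepsilon$-close to it, controls included, for some $\varepsilon>0$. If $(q,y)$ is not abnormal, there are $C^1$ multipliers $\lambda_i,\bar\lambda_\alpha$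 such that $(*)$ holds on $[0,T]$. (2) Let $q,y,\lambda,\bar\lambda$ be $C^1$ on $[0,T]$, with $q$ in the chart domain and $(F^a(q,y,\dot y))_a\in\mathcal U$. Then $(*)$ holds if and only if $(q,y,\lambda,\bar\lambda)$ satisfies the Euler–Lagrange equations of $\widetilde{\mathcal L}$, i.e. those for $\mathcal L$ with the constraints $\dot q^i=\rho^i_Ay^A$ and $\Phi^\alpha=0$; and if and only if $\int_0^T\widetilde{\mathcal L}\,dt$ is stationary at $(q,y,\lambda,\bar\lambda)$ under all smooth variations vanishing at $0$ and $T$. -/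

import Mathlib

open Set Bundle
open scoped Manifold ContDiff

noncomputable section

namespace NonholonomicControl

section Geometry

variable {n : ℕ} {Q : Type*} [TopologicalSpace Q] [ChartedSpace (EuclideanSpace ℝ (Fin n)) Q]
  [IsManifold (𝓡 n) ∞ Q]
  {F : Type*} [NormedAddCommGroup F] [NormedSpace ℝ F]
  {E : Q → Type*} [TopologicalSpace (TotalSpace F E)] [∀ q, TopologicalSpace (E q)]
  [FiberBundle F E] [∀ q, AddCommGroup (E q)] [∀ q, Module ℝ (E q)] [VectorBundle ℝ F E]

/-- The derivative `v(f)` of a function along a tangent vector. -/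
def dirDeriv {n : ℕ} {Q : Type*} [TopologicalSpace Q]
    [ChartedSpace (EuclideanSpace ℝ (Fin n)) Q] (f : Q → ℝ) (q : Q)
    (v : TangentSpace (𝓡 n) q) : ℝ :=
  mfderiv (𝓡 n) 𝓘(ℝ, ℝ) f q v

/-- A Lie algebroid structure on the vector bundle `E → Q`: a Lie bracket on the smooth sections
and a smooth anchor `ρ : E → TQ` related by the Leibniz rule
`[X, f Y] = f [X, Y] + ρ(X)(f) Y`. -/
structure LieAlgebroid (n : ℕ) {Q : Type*} [TopologicalSpace Q]
    [ChartedSpace (EuclideanSpace ℝ (Fin n)) Q] [IsManifold (𝓡 n) ∞ Q]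
    (F : Type*) [NormedAddCommGroup F] [NormedSpace ℝ F]
    (E : Q → Type*) [TopologicalSpace (TotalSpace F E)] [∀ q, TopologicalSpace (E q)]
    [FiberBundle F E] [∀ q, AddCommGroup (E q)] [∀ q, Module ℝ (E q)] [VectorBundle ℝ F E] where
  bracket : Cₛ^∞⟮𝓡 n; F, E⟯ →ₗ[ℝ] Cₛ^∞⟮𝓡 n; F, E⟯ →ₗ[ℝ] Cₛ^∞⟮𝓡 n; F, E⟯
  anchor : ∀ q : Q, E q →ₗ[ℝ] TangentSpace (𝓡 n) q
  anchor_smooth : ∀ X : Cₛ^∞⟮𝓡 n; F, E⟯,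
    ContMDiff (𝓡 n) (𝓡 n).tangent ∞
      (fun q : Q => (⟨q, anchor q (X q)⟩ : TangentBundle (𝓡 n) Q))
  bracket_self : ∀ X, bracket X X = 0
  jacobi : ∀ X Y Z,
    bracket X (bracket Y Z) + bracket Y (bracket Z X) + bracket Z (bracket X Y) = 0
  leibniz : ∀ (X Y Z : Cₛ^∞⟮𝓡 n; F, E⟯) (f : Q → ℝ), ContMDiff (𝓡 n) 𝓘(ℝ, ℝ) ∞ f →
    (∀ q, Z q = f q • Y q) →
    ∀ q, bracket X Z q
      = f q • bracket X Y q + dirDeriv f q (anchor q (X q)) • Y q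

/-- A family of subspaces of the fibres of `E` is a smooth vector subbundle of rank `m` if near
every point it has a basis consisting of `m` smooth sections. -/
def IsSubbundle (n : ℕ) {Q : Type*} [TopologicalSpace Q]
    [ChartedSpace (EuclideanSpace ℝ (Fin n)) Q] [IsManifold (𝓡 n) ∞ Q]
    (F : Type*) [NormedAddCommGroup F] [NormedSpace ℝ F]
    {E : Q → Type*} [TopologicalSpace (TotalSpace F E)] [∀ q, TopologicalSpace (E q)]
    [FiberBundle F E] [∀ q, AddCommGroup (E q)] [∀ q, Module ℝ (E q)] [VectorBundle ℝ F E]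
    (D : ∀ q, Submodule ℝ (E q)) (m : ℕ) : Prop :=
  ∀ q₀ : Q, ∃ W : Set Q, IsOpen W ∧ q₀ ∈ W ∧ ∃ s : Fin m → Cₛ^∞⟮𝓡 n; F, E⟯,
    ∀ q ∈ W, LinearIndependent ℝ (fun A => s A q) ∧
      Submodule.span ℝ (range fun A => s A q) = D q

/-- A nonholonomic system `(D, G, V)` on a Lie algebroid: a vector subbundle `D ⊂ E` of rank `m`,
a nondegenerate bundle metric `G` on `E` for which `E = D ⊕ D^⊥`, and a smooth potential `V`. -/
structure NonholonomicSystem (𝒜 : LieAlgebroid n F E) (m : ℕ) where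
  D : ∀ q : Q, Submodule ℝ (E q)
  subbundle : IsSubbundle n F D m
  G : ∀ q : Q, LinearMap.BilinForm ℝ (E q)
  G_symm : ∀ q, (G q).IsSymm
  G_nondegenerate : ∀ q, (G q).Nondegenerate
  G_smooth : ∀ X Y : Cₛ^∞⟮𝓡 n; F, E⟯,
    ContMDiff (𝓡 n) 𝓘(ℝ, ℝ) ∞ (fun q => G q (X q) (Y q))
  orthogonal_decomposition : ∀ q, IsCompl (D q) ((G q).orthogonal (D q))
  V : Q → ℝ
  V_smooth : ContMDiff (𝓡 n) 𝓘(ℝ, ℝ) ∞ V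

/-- The derivative `ρ(v)(f)` of a function along the anchor of `v ∈ E_q`. -/
def LieAlgebroid.lieDeriv (𝒜 : LieAlgebroid n F E) (f : Q → ℝ) (q : Q) (v : E q) : ℝ :=
  dirDeriv f q (𝒜.anchor q v)

namespace NonholonomicSystem

variable {𝒜 : LieAlgebroid n F E} {m : ℕ} (S : NonholonomicSystem 𝒜 m)

/-- The orthogonal projector `E → D`. -/
def proj (q : Q) : E q →ₗ[ℝ] S.D q :=
  Submodule.projectionOnto (S.D q) ((S.G q).orthogonal (S.D q)) (S.orthogonal_decomposition q)

/-- The projected bracket `[[X, Y]]_D = P [[X, Y]]_E`. -/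
def bracketD (X Y : Cₛ^∞⟮𝓡 n; F, E⟯) (q : Q) : E q :=
  S.proj q (𝒜.bracket X Y q)

/-- The right-hand side of the Koszul formula, i.e. `2 G(∇_X Y, Z)` for the Levi-Civita
connection `∇` of the restricted metric on `D`, for sections `X, Y, Z` of `D`. -/
def koszul (X Y Z : Cₛ^∞⟮𝓡 n; F, E⟯) (q : Q) : ℝ :=
  𝒜.lieDeriv (fun p => S.G p (Y p) (Z p)) q (X q)
    + 𝒜.lieDeriv (fun p => S.G p (X p) (Z p)) q (Y q)
    - 𝒜.lieDeriv (fun p => S.G p (X p) (Y p)) q (Z q)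
    + S.G q (X q) (S.bracketD Z Y q)
    + S.G q (Y q) (S.bracketD Z X q)
    - S.G q (Z q) (S.bracketD Y X q)

end NonholonomicSystem

/-- Local coordinates adapted to an underactuated system: a chart of `Q` and sections
`e_a` (`a : Fin k`), `e_α` (`α : Fin r`) of `D` which over the chart domain form a basis of `D`,
the `e_a` spanning the control subbundle `Dc`. -/
structure AdaptedFrame {𝒜 : LieAlgebroid n F E} {m : ℕ} (S : NonholonomicSystem 𝒜 m)
    (Dc : ∀ q : Q, Submodule ℝ (E q)) (k r : ℕ) where
  chart : OpenPartialHomeomorph Q (EuclideanSpace ℝ (Fin n))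
  chart_mem : chart ∈ IsManifold.maximalAtlas (𝓡 n) ∞ Q
  e : Fin k ⊕ Fin r → Cₛ^∞⟮𝓡 n; F, E⟯
  e_mem : ∀ A q, e A q ∈ S.D q
  linearIndependent : ∀ q ∈ chart.source, LinearIndependent ℝ (fun A => e A q)
  span_eq : ∀ q ∈ chart.source, Submodule.span ℝ (range fun A => e A q) = S.D q
  span_control : ∀ q ∈ chart.source,
    Submodule.span ℝ (range fun a : Fin k => e (Sum.inl a) q) = Dc q

namespace AdaptedFrame

variable {𝒜 : LieAlgebroid n F E} {m : ℕ} {S : NonholonomicSystem 𝒜 m}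
  {Dc : ∀ q : Q, Submodule ℝ (E q)} {k r : ℕ} (fr : AdaptedFrame S Dc k r)

/-- The element `y^A e_A(q)` of `D_q`. -/
def vec (q : Q) (y : Fin k ⊕ Fin r → ℝ) : S.D q :=
  ∑ A, y A • (⟨fr.e A q, fr.e_mem A q⟩ : S.D q)

/-- The matrix `G_{AB}` of the restricted metric. -/
def gram (q : Q) : Matrix (Fin k ⊕ Fin r) (Fin k ⊕ Fin r) ℝ :=
  Matrix.of fun A B => S.G q (fr.e A q) (fr.e B q)

/-- The Christoffel symbols `Γ^C_{AB}`, `∇_{e_A} e_B = Γ^C_{AB} e_C`: solving the Koszul formula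
`2 G(∇_{e_A} e_B, e_K) = koszul e_A e_B e_K` for the components of `∇_{e_A} e_B`. -/
def christoffel (q : Q) (C A B : Fin k ⊕ Fin r) : ℝ :=
  ∑ K, (fr.gram q)⁻¹ C K * (S.koszul (fr.e A) (fr.e B) (fr.e K) q / 2)

/-- The components `G^{CB} ρ_B^i ∂V/∂q^i` of the gradient of the potential. -/
def gradV (q : Q) (C : Fin k ⊕ Fin r) : ℝ :=
  ∑ B, (fr.gram q)⁻¹ C B * 𝒜.lieDeriv S.V q (fr.e B q)

/-- The coordinate velocity `q̇^i = dq^i(ρ(v))` prescribed by `v ∈ E_q`. -/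
def anchorCoord (q : Q) (v : E q) : EuclideanSpace ℝ (Fin n) :=
  mfderiv (𝓡 n) (𝓡 n) fr.chart q (𝒜.anchor q v)

/-- The anchor components `ρ^i_A` in the chart. -/
def rho (x : EuclideanSpace ℝ (Fin n)) (i : Fin n) (A : Fin k ⊕ Fin r) : ℝ :=
  fr.anchorCoord (fr.chart.symm x) (fr.e A (fr.chart.symm x)) i

/-- `ẏ^C + Γ^C_{AB} y^A y^B + G^{CB} ρ_B^i ∂V/∂q^i`: the components of
`∇_γ γ + grad V` along an admissible curve `γ = (x, y)`, where `yd` is the velocity of `y`. -/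
def force (x : EuclideanSpace ℝ (Fin n)) (y yd : Fin k ⊕ Fin r → ℝ) (C : Fin k ⊕ Fin r) : ℝ :=
  yd C + ∑ A, ∑ B, fr.christoffel (fr.chart.symm x) C A B * y A * y B
    + fr.gradV (fr.chart.symm x) C

/-- The constraint functions `Φ^α`, the unactuated part of the dynamics. -/
def Phi (α : Fin r) (x : EuclideanSpace ℝ (Fin n)) (y yd : Fin k ⊕ Fin r → ℝ) : ℝ :=
  fr.force x y yd (Sum.inr α)

/-- The cost `C : D × 𝒰 → ℝ` in local coordinates. -/
def localCost (cost : (q : Q) → S.D q → (Fin k → ℝ) → ℝ)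
    (x : EuclideanSpace ℝ (Fin n)) (y : Fin k ⊕ Fin r → ℝ) (u : Fin k → ℝ) : ℝ :=
  cost (fr.chart.symm x) (fr.vec (fr.chart.symm x) y) u

/-- The cost is smooth on `D × 𝒰` over the chart domain. -/
def SmoothCost (𝒰 : Set (Fin k → ℝ)) (cost : (q : Q) → S.D q → (Fin k → ℝ) → ℝ) : Prop :=
  ContDiffOn ℝ ∞
    (fun p : EuclideanSpace ℝ (Fin n) × (Fin k ⊕ Fin r → ℝ) × (Fin k → ℝ) =>
      fr.localCost cost p.1 p.2.1 p.2.2)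
    (fr.chart.target ×ˢ univ ×ˢ 𝒰)

/-- The Lagrangian `𝓛(q, y, ẏ)` obtained by substituting the actuated equations for the
controls in the cost. -/
def lagrangian (cost : (q : Q) → S.D q → (Fin k → ℝ) → ℝ)
    (x : EuclideanSpace ℝ (Fin n)) (y yd : Fin k ⊕ Fin r → ℝ) : ℝ :=
  fr.localCost cost x y (fun c => fr.force x y yd (Sum.inl c))

/-- `(x, y, u)` is a solution, of class `C^N` on `[0, T]`, of the underactuated controlled
nonholonomic problem with control values in `𝒰`: the curve `γ = y^A e_A` over the base curve with
coordinates `x` is admissible and `∇_γ γ + grad V = u^a e_a`. -/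
structure IsSolution (𝒰 : Set (Fin k → ℝ)) (N : ℕ∞) (T : ℝ)
    (x : ℝ → EuclideanSpace ℝ (Fin n)) (y : ℝ → Fin k ⊕ Fin r → ℝ) (u : ℝ → Fin k → ℝ) :
    Prop where
  x_regular : ContDiffOn ℝ N x (Icc 0 T)
  y_regular : ContDiffOn ℝ N y (Icc 0 T)
  x_mem : ∀ t ∈ Icc 0 T, x t ∈ fr.chart.target
  u_mem : ∀ t ∈ Icc 0 T, u t ∈ 𝒰
  admissible : ∀ t ∈ Icc 0 T, derivWithin x (Icc 0 T) t =
    fr.anchorCoord (fr.chart.symm (x t)) (fr.vec (fr.chart.symm (x t)) (y t))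
  dynamics : ∀ t ∈ Icc 0 T,
    ∑ C, fr.force (x t) (y t) (derivWithin y (Icc 0 T) t) C • fr.e C (fr.chart.symm (x t))
      = ∑ a, u t a • fr.e (Sum.inl a) (fr.chart.symm (x t))

/-- The cost functional `𝒥 = ∫₀ᵀ C(γ(t), u(t)) dt`. -/
def totalCost (cost : (q : Q) → S.D q → (Fin k → ℝ) → ℝ) (T : ℝ)
    (x : ℝ → EuclideanSpace ℝ (Fin n)) (y : ℝ → Fin k ⊕ Fin r → ℝ) (u : ℝ → Fin k → ℝ) : ℝ :=
  ∫ t in (0 : ℝ)..T, fr.localCost cost (x t) (y t) (u t)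

/-- `(x', y', u')` is a competitor of `(x, y, u)` in the optimal control problem: a solution with
the same end points in `D`, uniformly `ε`-close together with its controls. -/
def IsCompetitor (𝒰 : Set (Fin k → ℝ)) (N : ℕ∞) (T ε : ℝ)
    (x : ℝ → EuclideanSpace ℝ (Fin n)) (y : ℝ → Fin k ⊕ Fin r → ℝ) (u : ℝ → Fin k → ℝ)
    (x' : ℝ → EuclideanSpace ℝ (Fin n)) (y' : ℝ → Fin k ⊕ Fin r → ℝ) (u' : ℝ → Fin k → ℝ) :
    Prop :=
  fr.IsSolution 𝒰 N T x' y' u' ∧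
    x' 0 = x 0 ∧ y' 0 = y 0 ∧ x' T = x T ∧ y' T = y T ∧
    ∀ t ∈ Icc 0 T, ‖x' t - x t‖ < ε ∧ ‖y' t - y t‖ < ε ∧ ‖u' t - u t‖ < ε

/-- `(x, y, u)` locally extremizes the cost functional among the solutions with the same
end points. -/
def IsLocallyOptimal (𝒰 : Set (Fin k → ℝ)) (cost : (q : Q) → S.D q → (Fin k → ℝ) → ℝ)
    (N : ℕ∞) (T : ℝ)
    (x : ℝ → EuclideanSpace ℝ (Fin n)) (y : ℝ → Fin k ⊕ Fin r → ℝ) (u : ℝ → Fin k → ℝ) :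
    Prop :=
  fr.IsSolution 𝒰 N T x y u ∧ ∃ ε > 0,
    (∀ x' y' u', fr.IsCompetitor 𝒰 N T ε x y u x' y' u' →
      fr.totalCost cost T x y u ≤ fr.totalCost cost T x' y' u') ∨
    (∀ x' y' u', fr.IsCompetitor 𝒰 N T ε x y u x' y' u' →
      fr.totalCost cost T x' y' u' ≤ fr.totalCost cost T x y u)

/-- The system of necessary conditions on `[0, T]` for a Lagrangian `ℒ(q, y, ẏ)`, a curve
`(x, y)` and multipliers `λ_i`, `λ̄_α`. -/
structure NecessaryConditions
    (ℒ : EuclideanSpace ℝ (Fin n) → (Fin k ⊕ Fin r → ℝ) → (Fin k ⊕ Fin r → ℝ) → ℝ) (T : ℝ)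
    (x : ℝ → EuclideanSpace ℝ (Fin n)) (y : ℝ → Fin k ⊕ Fin r → ℝ)
    (lam : ℝ → Fin n → ℝ) (lamBar : ℝ → Fin r → ℝ) : Prop where
  lam_regular : ContDiffOn ℝ 1 lam (Icc 0 T)
  lamBar_regular : ContDiffOn ℝ 1 lamBar (Icc 0 T)
  momentum_regular : ∀ A, DifferentiableOn ℝ
    (fun t => fderiv ℝ (fun v => ℒ (x t) (y t) v) (derivWithin y (Icc 0 T) t) (Pi.single A 1))
    (Icc 0 T)
  base_eq : ∀ t ∈ Icc 0 T, ∀ i : Fin n,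
    0 = derivWithin (fun s => lam s i) (Icc 0 T) t
      + ∑ j, ∑ A, lam t j
          * fderiv ℝ (fun z => fr.rho z j A) (x t) (EuclideanSpace.single i 1) * y t A
      - fderiv ℝ (fun z => ℒ z (y t) (derivWithin y (Icc 0 T) t)) (x t)
          (EuclideanSpace.single i 1)
      - ∑ α, lamBar t α
          * fderiv ℝ (fun z => fr.Phi α z (y t) (derivWithin y (Icc 0 T) t)) (x t)
              (EuclideanSpace.single i 1)
  actuated_eq : ∀ t ∈ Icc 0 T, ∀ a : Fin k,
    0 = derivWithin (fun s => fderiv ℝ (fun v => ℒ (x s) (y s) v) (derivWithin y (Icc 0 T) s)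
          (Pi.single (Sum.inl a) 1)) (Icc 0 T) t
      + ∑ i, fr.rho (x t) i (Sum.inl a) * lam t i
      - fderiv ℝ (fun w => ℒ (x t) w (derivWithin y (Icc 0 T) t)) (y t)
          (Pi.single (Sum.inl a) 1)
      - ∑ α, lamBar t α * ∑ B,
          (fr.christoffel (fr.chart.symm (x t)) (Sum.inr α) (Sum.inl a) B
            + fr.christoffel (fr.chart.symm (x t)) (Sum.inr α) B (Sum.inl a)) * y t B
  unactuated_eq : ∀ t ∈ Icc 0 T, ∀ α : Fin r,
    0 = derivWithin (fun s => lamBar s α) (Icc 0 T) t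
      + derivWithin (fun s => fderiv ℝ (fun v => ℒ (x s) (y s) v) (derivWithin y (Icc 0 T) s)
          (Pi.single (Sum.inr α) 1)) (Icc 0 T) t
      + ∑ i, lam t i * fr.rho (x t) i (Sum.inr α)
      - fderiv ℝ (fun w => ℒ (x t) w (derivWithin y (Icc 0 T) t)) (y t)
          (Pi.single (Sum.inr α) 1)
      - ∑ β, lamBar t β * ∑ B,
          (fr.christoffel (fr.chart.symm (x t)) (Sum.inr β) (Sum.inr α) B
            + fr.christoffel (fr.chart.symm (x t)) (Sum.inr β) B (Sum.inr α)) * y t B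
  admissible : ∀ t ∈ Icc 0 T, ∀ i : Fin n,
    0 = derivWithin x (Icc 0 T) t i - ∑ A, fr.rho (x t) i A * y t A
  constraint : ∀ t ∈ Icc 0 T, ∀ α : Fin r,
    0 = fr.Phi α (x t) (y t) (derivWithin y (Icc 0 T) t)

/-- The curve is abnormal if the system with the Lagrangian dropped has a multiplier that is
not identically zero. -/
def IsAbnormal (T : ℝ) (x : ℝ → EuclideanSpace ℝ (Fin n)) (y : ℝ → Fin k ⊕ Fin r → ℝ) : Prop :=
  ∃ (lam : ℝ → Fin n → ℝ) (lamBar : ℝ → Fin r → ℝ),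
    fr.NecessaryConditions (fun _ _ _ => 0) T x y lam lamBar ∧
    ∃ t ∈ Icc 0 T, lam t ≠ 0 ∨ lamBar t ≠ 0

/-- The extended Lagrangian
`𝓛 + λ_i (q̇^i - ρ^i_A y^A) + λ̄_α Φ^α`, as a function of `w = (q, y, λ, λ̄)` and its velocity. -/
def extendedLagrangian (cost : (q : Q) → S.D q → (Fin k → ℝ) → ℝ)
    (w wd : EuclideanSpace ℝ (Fin n) × (Fin k ⊕ Fin r → ℝ) × (Fin n → ℝ) × (Fin r → ℝ)) : ℝ :=
  fr.lagrangian cost w.1 w.2.1 wd.2.1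
    + ∑ i, w.2.2.1 i * (wd.1 i - ∑ A, fr.rho w.1 i A * w.2.1 A)
    + ∑ α, w.2.2.2 α * fr.Phi α w.1 w.2.1 wd.2.1

end AdaptedFrame

end Geometry

section Variational

variable {W : Type*} [NormedAddCommGroup W] [NormedSpace ℝ W]

/-- The Euler-Lagrange equations `d/dt (∂Λ/∂ẇ) = ∂Λ/∂w` on `[0, T]`. -/
def EulerLagrange (Λ : W → W → ℝ) (T : ℝ) (w : ℝ → W) : Prop :=
  ∀ t ∈ Icc 0 T, HasDerivWithinAt
    (fun s => fderiv ℝ (fun v => Λ (w s) v) (derivWithin w (Icc 0 T) s))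
    (fderiv ℝ (fun z => Λ z (derivWithin w (Icc 0 T) t)) (w t)) (Icc 0 T) t

/-- The action `∫₀ᵀ Λ(w, ẇ) dt` is stationary at `w` under smooth variations vanishing at the
end points. -/
def IsStationary (Λ : W → W → ℝ) (T : ℝ) (w : ℝ → W) : Prop :=
  ∀ δ : ℝ → W, ContDiff ℝ ∞ δ → δ 0 = 0 → δ T = 0 →
    HasDerivAt (fun s : ℝ => ∫ t in (0 : ℝ)..T,
      Λ (w t + s • δ t) (derivWithin (fun τ => w τ + s • δ τ) (Icc 0 T) t)) 0 0

end Variational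

end NonholonomicControl

end

/-!
For the first part, a solution is a trajectory of the control system obtained by solving the
equations of motion for `(q̇, ẏ)`. In the Banach space of continuous pairs (state, control) the
constraint `z - ∫₀ f(z, u) = const` has a derivative that is onto already in the direction of the
state, because `1 - (a Volterra operator)` is invertible. The Lagrange multiplier rule for the cost
subject to this constraint and to the end point condition gives `(p₀, ξ(T)) ≠ 0` with `ξ` solving
Pontryagin's equations. Along a solution `𝓛̃ = C + ξ(ż - f(z, u))` when the multipliers are the
components of `ξ` that are not dual to the actuated directions, so these equations become the
Euler–Lagrange equations of `𝓛̃`. If `p₀ = 0`, the multipliers exhibit the curve as abnormal: the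
remaining components of `ξ(T)` vanish by stationarity of the Hamiltonian in the control.

For the second part, the system is the Euler–Lagrange system of `𝓛̃` written in components, and the
lemma of du Bois-Reymond passes between it and stationarity of the action.
-/

noncomputable section

namespace NonholonomicControl

section Superposition

open Filter Topology Metric

variable {V W X : Type*} [NormedAddCommGroup V] [NormedSpace ℝ V]
  [NormedAddCommGroup W] [NormedSpace ℝ W] [TopologicalSpace X]

/-- The superposition operator `c ↦ g ∘ c` on continuous curves. -/
def superposition {V W : Type*} [TopologicalSpace V] [TopologicalSpace W] {g : V → W}
    (hg : Continuous g) (c : C(X, V)) : C(X, W) :=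
  (⟨g, hg⟩ : C(V, W)).comp c

@[simp] theorem superposition_apply {V W : Type*} [TopologicalSpace V] [TopologicalSpace W]
    {g : V → W} (hg : Continuous g) (c : C(X, V)) (t : X) : superposition hg c t = g (c t) := rfl

/-- The curve `t ↦ g'(c t)` of derivatives of a `C^1` map `g` along a continuous curve `c`. -/
def fderivAlong {g : V → W} (hg : ContDiff ℝ 1 g) (c : C(X, V)) : C(X, V →L[ℝ] W) :=
  ⟨fun t => fderiv ℝ g (c t), (hg.continuous_fderiv one_ne_zero).comp c.continuous⟩

@[simp] theorem fderivAlong_apply {g : V → W} (hg : ContDiff ℝ 1 g) (c : C(X, V)) (t : X) :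
    fderivAlong hg c t = fderiv ℝ g (c t) := rfl

variable [CompactSpace X]

theorem exists_contDiff_eqOn_ball [FiniteDimensional ℝ V] {m : ℕ∞} {Ω : Set V} (hΩ : IsOpen Ω)
    {g : V → W} (hg : ContDiffOn ℝ m g Ω) (c : C(X, V)) (hc : ∀ t, c t ∈ Ω) :
    ∃ g' : V → W, ContDiff ℝ m g' ∧
      ∃ ε > 0, ∀ t, ball (c t) ε ⊆ Ω ∧ EqOn g' g (ball (c t) ε) := by
  have hK : IsCompact (range c) := isCompact_range c.continuous
  have hKΩ : range c ⊆ Ω := range_subset_iff.mpr hc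
  obtain ⟨χ, h0, h1, -⟩ := exists_contMDiffMap_zero_one_nhds_of_isClosed 𝓘(ℝ, V) (n := ⊤)
    hΩ.isClosed_compl hK.isClosed (disjoint_compl_left_iff_subset.mpr hKΩ)
  have hχ : ContDiff ℝ m χ := χ.contMDiff.contDiff.of_le (by exact_mod_cast le_top)
  refine ⟨fun x => χ x • g x, contDiff_iff_contDiffAt.mpr fun x => ?_, ?_⟩
  · by_cases hx : x ∈ Ω
    · exact hχ.contDiffAt.smul (hg.contDiffAt (hΩ.mem_nhds hx))
    · have : (fun x => χ x • g x) =ᶠ[𝓝 x] fun _ => 0 := by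
        filter_upwards [h0.filter_mono (nhds_le_nhdsSet (show x ∈ Ωᶜ from hx))] with y hy
        simp [hy]
      exact contDiffAt_const.congr_of_eventuallyEq this
  · obtain ⟨O, hO, hKO, hO1⟩ := eventually_nhdsSet_iff_exists.mp h1
    obtain ⟨ε, hε, hsub⟩ := hK.exists_thickening_subset_open (hO.inter hΩ)
      (subset_inter hKO hKΩ)
    have hball : ∀ t, ball (c t) ε ⊆ O ∩ Ω := fun t =>
      (ball_subset_thickening (mem_range_self t) ε).trans hsub
    exact ⟨ε, hε, fun t => ⟨(hball t).trans inter_subset_right,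
      fun x hx => by simp [hO1 x (hball t hx).1]⟩⟩

/-- The continuous linear map `h ↦ (t ↦ A t (h t))` on spaces of continuous functions. -/
def pointwiseCLM (A : C(X, V →L[ℝ] W)) : C(X, V) →L[ℝ] C(X, W) :=
  LinearMap.mkContinuous
    { toFun := fun h => ⟨fun t => A t (h t), A.continuous.clm_apply h.continuous⟩
      map_add' := fun h h' => by ext t; simp
      map_smul' := fun c h => by ext t; simp } ‖A‖ fun h => by
    refine (ContinuousMap.norm_le _ (by positivity)).mpr fun t => ?_
    exact (A t).le_of_opNorm_le_of_le (A.norm_coe_le_norm t) (h.norm_coe_le_norm t)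

@[simp] theorem pointwiseCLM_apply (A : C(X, V →L[ℝ] W)) (h : C(X, V)) (t : X) :
    pointwiseCLM A h t = A t (h t) := rfl

theorem hasStrictFDerivAt_superposition {g : V → W} (hg : ContDiff ℝ 1 g) (c : C(X, V)) :
    HasStrictFDerivAt (superposition hg.continuous) (pointwiseCLM (fderivAlong hg c)) c := by
  rw [hasStrictFDerivAt_iff_isLittleO, Asymptotics.isLittleO_iff]
  intro ε hε
  have hunif := (isCompact_range c.continuous).uniformContinuousAt_of_continuousAt (fderiv ℝ g)
    (fun v _ => (hg.continuous_fderiv one_ne_zero).continuousAt) (dist_mem_uniformity hε)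
  obtain ⟨δ, hδ, H⟩ := mem_uniformity_dist.mp hunif
  have hnear : ∀ᶠ p : C(X, V) × C(X, V) in 𝓝 (c, c), dist p.1 c < δ ∧ dist p.2 c < δ := by
    rw [nhds_prod_eq]
    exact prod_mem_prod (ball_mem_nhds c hδ) (ball_mem_nhds c hδ)
  filter_upwards [hnear] with p hp
  refine (ContinuousMap.norm_le _ (by positivity)).mpr fun t => ?_
  have hball : ∀ v ∈ ball (c t) δ, ‖fderiv ℝ g v - fderiv ℝ g (c t)‖ ≤ ε := fun v hv => by
    have := @H (c t) v (by rwa [dist_comm]) (mem_range_self t)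
    rw [← dist_eq_norm, dist_comm]
    exact le_of_lt this
  have hmean := (convex_ball (c t) δ).norm_image_sub_le_of_norm_hasFDerivWithin_le'
    (fun v _ => ((hg.differentiable one_ne_zero) v).hasFDerivAt.hasFDerivWithinAt) hball
    (x := p.2 t) (y := p.1 t) ((ContinuousMap.dist_apply_le_dist t).trans_lt hp.2)
    ((ContinuousMap.dist_apply_le_dist t).trans_lt hp.1)
  refine hmean.trans ?_
  gcongr
  exact (p.1 - p.2).norm_coe_le_norm t

end Superposition

section Volterra

open Filter Topology MeasureTheory intervalIntegral

variable {V : Type*} [NormedAddCommGroup V] [NormedSpace ℝ V] {T : ℝ}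

theorem norm_IccExtend_le {V : Type*} [NormedAddCommGroup V] {T : ℝ} (hT : 0 ≤ T)
    (h : C(Icc (0 : ℝ) T, V)) (t : ℝ) : ‖IccExtend hT h t‖ ≤ ‖h‖ :=
  h.norm_coe_le_norm _

variable [CompleteSpace V]

theorem integral_eq_sub_of_hasDerivWithinAt_Icc {a b : ℝ} (hab : a ≤ b) {g g' : ℝ → V}
    (hg : ∀ t ∈ Icc a b, HasDerivWithinAt g (g' t) (Icc a b) t)
    (hg' : ContinuousOn g' (Icc a b)) : ∫ t in a..b, g' t = g b - g a :=
  integral_eq_sub_of_hasDerivAt_of_le hab (fun t ht => (hg t ht).continuousWithinAt)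
    (fun t ht => (hg t (Ioo_subset_Icc_self ht)).hasDerivAt (Icc_mem_nhds ht.1 ht.2))
    ((uIcc_of_le hab ▸ hg').intervalIntegrable)

theorem hasDerivAt_integral_IccExtend (hT : 0 ≤ T) (h : C(Icc (0 : ℝ) T, V)) (t : ℝ) :
    HasDerivAt (fun t => ∫ s in (0 : ℝ)..t, IccExtend hT h s) (IccExtend hT h t) t :=
  integral_hasDerivAt_right (h.continuous.Icc_extend'.intervalIntegrable _ _)
    (h.continuous.Icc_extend'.stronglyMeasurableAtFilter _ _) h.continuous.Icc_extend'.continuousAt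

/-- The integration operator `h ↦ (t ↦ ∫₀ᵗ h)` on continuous functions. -/
def primitiveCLM (hT : 0 ≤ T) : C(Icc (0 : ℝ) T, V) →L[ℝ] C(Icc (0 : ℝ) T, V) :=
  LinearMap.mkContinuous
    { toFun := fun h => ⟨fun t => ∫ s in (0 : ℝ)..t, IccExtend hT h s,
        (continuous_iff_continuousAt.mpr fun t =>
          (hasDerivAt_integral_IccExtend hT h t).continuousAt).comp continuous_subtype_val⟩
      map_add' := fun h h' => by
        ext t
        simpa [IccExtend] using integral_add (h.continuous.Icc_extend'.intervalIntegrable 0 t)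
          (h'.continuous.Icc_extend'.intervalIntegrable 0 t)
      map_smul' := fun c h => by
        ext t
        simp [IccExtend] } T fun h => by
    refine (ContinuousMap.norm_le _ (by positivity)).mpr fun t => ?_
    have := norm_integral_le_of_norm_le_const (a := 0) (b := t) (f := IccExtend hT h)
      (fun s _ => norm_IccExtend_le hT h s)
    refine this.trans ?_
    rw [sub_zero, abs_of_nonneg t.2.1, mul_comm]
    exact mul_le_mul_of_nonneg_right t.2.2 (norm_nonneg _)

theorem primitiveCLM_apply (hT : 0 ≤ T) (h : C(Icc (0 : ℝ) T, V)) (t : Icc (0 : ℝ) T) :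
    primitiveCLM hT h t = ∫ s in (0 : ℝ)..t, IccExtend hT h s := rfl

theorem eq_const_add_primitiveCLM_iff (hT : 0 ≤ T) {h g : C(Icc (0 : ℝ) T, V)} {h' g' : ℝ → V}
    (hh : ∀ t : Icc (0 : ℝ) T, h t = h' t) (hg : ∀ t : Icc (0 : ℝ) T, g t = g' t) {v₀ : V} :
    h = ContinuousMap.const _ v₀ + primitiveCLM hT g ↔
      h' 0 = v₀ ∧ ∀ t ∈ Icc 0 T, HasDerivWithinAt h' (g' t) (Icc 0 T) t := by
  have hgI : ∀ t ∈ Icc 0 T, IccExtend hT g t = g' t := fun t ht => by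
    rw [IccExtend_of_mem hT _ ht, hg]
  constructor
  · intro heq
    have hval : ∀ t ∈ Icc 0 T, h' t = v₀ + ∫ s in (0 : ℝ)..t, IccExtend hT g s := by
      intro t ht
      rw [← hh ⟨t, ht⟩, heq]
      rfl
    refine ⟨(hval 0 ⟨le_rfl, hT⟩).trans (by rw [integral_same, add_zero]), fun t ht => ?_⟩
    rw [← hgI t ht]
    exact ((hasDerivAt_integral_IccExtend hT g t).const_add v₀).hasDerivWithinAt.congr hval
      (hval t ht)
  · rintro ⟨h0, hd⟩
    ext t
    have hFTC := integral_eq_sub_of_hasDerivWithinAt_Icc t.2.1 (fun s hs => by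
      have hsT : s ∈ Icc 0 T := ⟨hs.1, hs.2.trans t.2.2⟩
      rw [hgI s hsT]
      exact (hd s hsT).mono (Icc_subset_Icc_right t.2.2)) g.continuous.Icc_extend'.continuousOn
    rw [ContinuousMap.add_apply, ContinuousMap.const_apply, primitiveCLM_apply, hFTC, h0, hh,
      add_sub_cancel]

/-- Integration over `[0, T]` as a continuous linear map on continuous functions. -/
def integralCLM (hT : 0 ≤ T) : C(Icc (0 : ℝ) T, V) →L[ℝ] V :=
  ContinuousMap.evalCLM ℝ (⟨T, hT, le_rfl⟩ : Icc (0 : ℝ) T) ∘L primitiveCLM hT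

theorem integralCLM_eq (hT : 0 ≤ T) (h : C(Icc (0 : ℝ) T, V)) {g : ℝ → V}
    (hg : ∀ t : Icc (0 : ℝ) T, h t = g t) : integralCLM hT h = ∫ s in (0 : ℝ)..T, g s := by
  change ∫ s in (0 : ℝ)..T, IccExtend hT h s = _
  refine integral_congr fun t ht => ?_
  rw [uIcc_of_le hT] at ht
  rw [IccExtend_of_mem hT _ ht, hg]

/-- The Volterra operator `h ↦ (t ↦ ∫₀ᵗ A h)`. -/
def volterra (hT : 0 ≤ T) (A : C(Icc (0 : ℝ) T, V →L[ℝ] V)) :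
    C(Icc (0 : ℝ) T, V) →L[ℝ] C(Icc (0 : ℝ) T, V) :=
  primitiveCLM hT ∘L pointwiseCLM A

theorem norm_volterra_pow_apply_le (hT : 0 ≤ T) (A : C(Icc (0 : ℝ) T, V →L[ℝ] V)) (j : ℕ)
    (h : C(Icc (0 : ℝ) T, V)) (t : Icc (0 : ℝ) T) :
    ‖(volterra hT A ^ j) h t‖ ≤ ‖A‖ ^ j * (t : ℝ) ^ j / j.factorial * ‖h‖ := by
  induction j generalizing t with
  | zero => simpa using h.norm_coe_le_norm t
  | succ j ih =>
    rw [pow_succ' (volterra hT A) j]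
    change ‖∫ s in (0 : ℝ)..t, IccExtend hT (pointwiseCLM A ((volterra hT A ^ j) h)) s‖ ≤ _
    have hle : ∀ s ∈ Ioc (0 : ℝ) t,
        ‖IccExtend hT (pointwiseCLM A ((volterra hT A ^ j) h)) s‖ ≤
          ‖A‖ ^ (j + 1) / j.factorial * ‖h‖ * s ^ j := by
      intro s hs
      have hsT : s ∈ Icc 0 T := ⟨hs.1.le, hs.2.trans t.2.2⟩
      rw [IccExtend_of_mem hT _ hsT, pointwiseCLM_apply]
      refine ((A _).le_of_opNorm_le_of_le (A.norm_coe_le_norm _) (ih _)).trans_eq ?_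
      ring
    refine (norm_integral_le_of_norm_le t.2.1 (ae_of_all _ hle)
      (Continuous.intervalIntegrable (by fun_prop) _ _)).trans_eq ?_
    rw [intervalIntegral.integral_const_mul, integral_pow, Nat.factorial_succ]
    push_cast
    field_simp
    simp

theorem norm_volterra_pow_le (hT : 0 ≤ T) (A : C(Icc (0 : ℝ) T, V →L[ℝ] V)) (j : ℕ) :
    ‖volterra hT A ^ j‖ ≤ (‖A‖ * T) ^ j / j.factorial := by
  refine ContinuousLinearMap.opNorm_le_bound _ (by positivity) fun h => ?_
  refine (ContinuousMap.norm_le _ (by positivity)).mpr fun t =>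
    (norm_volterra_pow_apply_le hT A j h t).trans ?_
  have ht0 := t.2.1
  have htT := t.2.2
  rw [mul_pow]
  gcongr

theorem isUnit_one_sub_of_norm_pow_lt_one {R : Type*} [NormedRing R] [HasSummableGeomSeries R]
    {b : R} {j : ℕ} (hj : ‖b ^ j‖ < 1) : IsUnit (1 - b) := by
  have hcomm : Commute (1 - b) (∑ i ∈ Finset.range j, b ^ i) :=
    (Commute.one_left _).sub_left (Commute.sum_right _ _ _ fun i _ => Commute.self_pow b i)
  have hu := isUnit_one_sub_of_norm_lt_one hj
  rw [← mul_neg_geom_sum, hcomm.isUnit_mul_iff] at hu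
  exact hu.1

theorem isUnit_one_sub_volterra (hT : 0 ≤ T) (A : C(Icc (0 : ℝ) T, V →L[ℝ] V)) :
    IsUnit (1 - volterra hT A) := by
  obtain ⟨j, hj⟩ := ((FloorSemiring.tendsto_pow_div_factorial_atTop (‖A‖ * T)).eventually
    (gt_mem_nhds zero_lt_one)).exists
  exact isUnit_one_sub_of_norm_pow_lt_one (R := C(Icc (0 : ℝ) T, V) →L[ℝ] C(Icc (0 : ℝ) T, V))
    ((norm_volterra_pow_le hT A j).trans_lt hj)

theorem exists_sub_volterra_eq (hT : 0 ≤ T) (A : C(Icc (0 : ℝ) T, V →L[ℝ] V))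
    (g : C(Icc (0 : ℝ) T, V)) : ∃ h, h - volterra hT A h = g :=
  (ContinuousLinearMap.isUnit_iff_bijective.mp (isUnit_one_sub_volterra hT A)).2 g

theorem exists_linear_ode_solution (hT : 0 ≤ T) {A : ℝ → V →L[ℝ] V} {b : ℝ → V}
    (hA : ContinuousOn A (Icc 0 T)) (hb : ContinuousOn b (Icc 0 T)) (v₀ : V) :
    ∃ z : ℝ → V, z 0 = v₀ ∧ ∀ t ∈ Icc 0 T,
      HasDerivWithinAt z (A t (z t) + b t) (Icc 0 T) t := by
  let A' : C(Icc (0 : ℝ) T, V →L[ℝ] V) := ⟨fun t => A t, hA.domRestrict⟩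
  let b' : C(Icc (0 : ℝ) T, V) := ⟨fun t => b t, hb.domRestrict⟩
  obtain ⟨h, hh⟩ := exists_sub_volterra_eq hT A'
    (ContinuousMap.const _ v₀ + primitiveCLM hT b')
  have hint : h = ContinuousMap.const _ v₀ + primitiveCLM hT (pointwiseCLM A' h + b') := by
    rw [map_add, add_left_comm, ← hh]
    exact (add_sub_cancel (volterra hT A' h) h).symm
  exact ⟨IccExtend hT h, (eq_const_add_primitiveCLM_iff hT (fun t => (IccExtend_val hT h t).symm)
    (g' := fun t => A t (IccExtend hT h t) + b t) fun t => by
      rw [IccExtend_val]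
      rfl).mp hint⟩

theorem exists_linear_terminal_value_solution (hT : 0 ≤ T) {A : ℝ → V →L[ℝ] V} {b : ℝ → V}
    (hA : ContinuousOn A (Icc 0 T)) (hb : ContinuousOn b (Icc 0 T)) (v₁ : V) :
    ∃ z : ℝ → V, z T = v₁ ∧ ∀ t ∈ Icc 0 T,
      HasDerivWithinAt z (A t (z t) + b t) (Icc 0 T) t := by
  have hflip : MapsTo (fun t => T - t) (Icc 0 T) (Icc 0 T) := fun t ht =>
    ⟨sub_nonneg.mpr ht.2, sub_le_self _ ht.1⟩
  have hcont : ContinuousOn (fun t => T - t) (Icc 0 T) := by fun_prop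
  obtain ⟨z, hz0, hz⟩ := exists_linear_ode_solution hT ((hA.comp hcont hflip).neg)
    ((hb.comp hcont hflip).neg) v₁
  refine ⟨fun t => z (T - t), by simpa using hz0, fun t ht => ?_⟩
  refine ((hz (T - t) (hflip ht)).scomp t
    ((hasDerivAt_id t).const_sub T).hasDerivWithinAt hflip).congr_deriv ?_
  simp [add_comm]

end Volterra

section CalculusOfVariations

open Filter Topology MeasureTheory intervalIntegral

variable {T : ℝ} {V : Type*} [NormedAddCommGroup V] [NormedSpace ℝ V] [CompleteSpace V]

theorem eq_zero_of_integral_contDiff_smul_eq_zero (hT : 0 < T) {g : ℝ → V}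
    (hg : ContinuousOn g (Icc 0 T))
    (h : ∀ ψ : ℝ → ℝ, ContDiff ℝ ∞ ψ → ψ 0 = 0 → ψ T = 0 → ∫ t in (0 : ℝ)..T, ψ t • g t = 0) :
    ∀ t ∈ Icc 0 T, g t = 0 := by
  have hae : ∀ᵐ t, t ∈ Ioo 0 T → g t = 0 := by
    refine isOpen_Ioo.ae_eq_zero_of_integral_contDiff_smul_eq_zero
      ((hg.mono Ioo_subset_Icc_self).locallyIntegrableOn measurableSet_Ioo)
      fun ψ hψ _ hsupp => ?_
    have hz : ∀ t, t ∉ Ioo 0 T → ψ t = 0 := fun t ht =>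
      image_eq_zero_of_notMem_tsupport fun h => ht (hsupp h)
    rw [← h ψ hψ (hz 0 (by simp)) (hz T (by simp)), integral_of_le hT.le]
    refine (setIntegral_eq_integral_of_forall_compl_eq_zero fun t ht => ?_).symm
    rw [hz t fun h => ht ⟨h.1, h.2.le⟩, zero_smul]
  have hIoo : EqOn g (fun _ => 0) (Ioo 0 T) := by
    refine Measure.eqOn_Ioo_of_ae_eq (μ := volume) ?_ (hg.mono Ioo_subset_Icc_self)
      continuousOn_const
    rw [EventuallyEq, ae_restrict_iff' measurableSet_Ioo]
    exact hae
  refine hIoo.of_subset_closure hg continuousOn_const Ioo_subset_Icc_self ?_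
  rw [closure_Ioo hT.ne]

theorem contDiff_integral {m : ℕ∞} {η : ℝ → V} (hη : ContDiff ℝ m η) :
    ContDiff ℝ m (fun t => ∫ s in (0 : ℝ)..t, η s) := by
  have hd : ∀ t, HasDerivAt (fun t => ∫ s in (0 : ℝ)..t, η s) (η t) t := fun t =>
    integral_hasDerivAt_right (hη.continuous.intervalIntegrable _ _)
      (hη.continuous.stronglyMeasurableAtFilter _ _) hη.continuous.continuousAt
  have hderiv : deriv (fun t => ∫ s in (0 : ℝ)..t, η s) = η := funext fun t => (hd t).deriv
  refine ContDiff.of_le (n := m + 1) (contDiff_succ_iff_deriv.mpr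
    ⟨fun t => (hd t).differentiableAt, by simp, by rwa [hderiv]⟩) (by exact_mod_cast le_self_add)

theorem exists_eq_const_of_integral_deriv_smul_eq_zero (hT : 0 < T) {q : ℝ → V}
    (hq : ContinuousOn q (Icc 0 T))
    (h : ∀ ψ : ℝ → ℝ, ContDiff ℝ ∞ ψ → ψ 0 = 0 → ψ T = 0 →
      ∫ t in (0 : ℝ)..T, deriv ψ t • q t = 0) :
    ∃ c, ∀ t ∈ Icc 0 T, q t = c := by
  have hint : ∀ {φ : ℝ → ℝ}, Continuous φ →
      IntervalIntegrable (fun t => φ t • q t) volume 0 T := fun hφ =>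
    (uIcc_of_le hT.le ▸ hφ.continuousOn.smul hq).intervalIntegrable
  set c : V := T⁻¹ • ∫ t in (0 : ℝ)..T, q t with hc
  have hzero := eq_zero_of_integral_contDiff_smul_eq_zero hT (g := fun t => q t - c)
    (hq.sub continuousOn_const) fun φ hφ _ _ => ?_
  · exact ⟨c, fun t ht => sub_eq_zero.mp (hzero t ht)⟩
  -- Subtracting its mean from `φ` gives the derivative of a test function.
  set mean : ℝ := T⁻¹ * ∫ t in (0 : ℝ)..T, φ t with hmean
  have hη : ContDiff ℝ ∞ fun t => φ t - mean := hφ.sub contDiff_const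
  have hψT : ∫ s in (0 : ℝ)..T, (φ s - mean) = 0 := by
    rw [integral_sub (hφ.continuous.intervalIntegrable _ _) (by simp),
      intervalIntegral.integral_const, sub_zero, smul_eq_mul, hmean,
      mul_inv_cancel_left₀ hT.ne', sub_self]
  have hcentred := h _ (contDiff_integral hη) integral_same hψT
  simp only [hη.continuous.deriv_integral, sub_smul] at hcentred
  rw [integral_sub (hint hφ.continuous) (hint continuous_const), sub_eq_zero] at hcentred
  have hφc : IntervalIntegrable (fun t => φ t • c) volume 0 T :=
    (hφ.continuous.smul continuous_const).intervalIntegrable _ _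
  simp only [smul_sub]
  rw [integral_sub (hint hφ.continuous) hφc, hcentred, intervalIntegral.integral_smul,
    intervalIntegral.integral_smul_const, hc, hmean, smul_smul, mul_comm, sub_self]

theorem hasDerivWithinAt_of_integral_eq_zero (hT : 0 < T) {p ρ : ℝ → V}
    (hp : ContinuousOn p (Icc 0 T)) (hρ : ContinuousOn ρ (Icc 0 T))
    (h : ∀ ψ : ℝ → ℝ, ContDiff ℝ ∞ ψ → ψ 0 = 0 → ψ T = 0 →
      ∫ t in (0 : ℝ)..T, (deriv ψ t • p t + ψ t • ρ t) = 0) :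
    ∀ t ∈ Icc 0 T, HasDerivWithinAt p (ρ t) (Icc 0 T) t := by
  let ρ' : C(Icc (0 : ℝ) T, V) := ⟨fun t => ρ t, hρ.domRestrict⟩
  set I : ℝ → V := fun t => ∫ s in (0 : ℝ)..t, IccExtend hT.le ρ' s
  have hId : ∀ t ∈ Icc 0 T, HasDerivWithinAt I (ρ t) (Icc 0 T) t := fun t ht => by
    have := (hasDerivAt_integral_IccExtend hT.le ρ' t).hasDerivWithinAt (s := Icc 0 T)
    rwa [IccExtend_of_mem hT.le _ ht] at this
  have hIc : ContinuousOn I (Icc 0 T) := fun t ht => (hId t ht).continuousWithinAt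
  have hint : ∀ {g : ℝ → V}, ContinuousOn g (Icc 0 T) → IntervalIntegrable g volume 0 T :=
    fun hg => (uIcc_of_le hT.le ▸ hg).intervalIntegrable
  obtain ⟨c, hc⟩ := exists_eq_const_of_integral_deriv_smul_eq_zero hT (q := fun t => p t - I t)
    (hp.sub hIc) fun ψ hψ h0 h1 => by
      have hψ' : Continuous (deriv ψ) := hψ.continuous_deriv (by simp)
      have hsum : ∀ {g : ℝ → V}, ContinuousOn g (Icc 0 T) →
          ContinuousOn (fun t => deriv ψ t • g t + ψ t • ρ t) (Icc 0 T) := fun hg =>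
        (hψ'.continuousOn.smul hg).add (hψ.continuous.continuousOn.smul hρ)
      have hparts : ∫ t in (0 : ℝ)..T, (deriv ψ t • I t + ψ t • ρ t) = 0 := by
        rw [integral_eq_sub_of_hasDerivWithinAt_Icc hT.le (g := fun t => ψ t • I t)
          (fun t ht => ?_) (hsum hIc), h0, h1, zero_smul, zero_smul, sub_zero]
        rw [add_comm]
        exact (hψ.differentiable (by simp) t).hasDerivAt.hasDerivWithinAt.smul (hId t ht)
      have hdiff := integral_sub (hint (hsum hp)) (hint (hsum hIc))
      rw [h ψ hψ h0 h1, hparts, sub_zero] at hdiff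
      simpa only [add_sub_add_right_eq_sub, ← smul_sub] using hdiff
  have hpI : ∀ t ∈ Icc 0 T, p t = c + I t := fun t ht => sub_eq_iff_eq_add.mp (hc t ht)
  exact fun t ht => ((hId t ht).const_add c).congr hpI (hpI t ht)

theorem hasDerivAt_integral_comp_add_smul {W : Type*} [NormedAddCommGroup W] [NormedSpace ℝ W]
    [FiniteDimensional ℝ W] (hT : 0 ≤ T) {Ω : Set W} (hΩ : IsOpen Ω) {g : W → V}
    (hg : ContDiffOn ℝ 1 g Ω) {c η : ℝ → W} (hc : ContinuousOn c (Icc 0 T))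
    (hη : ContinuousOn η (Icc 0 T)) (hmem : ∀ t ∈ Icc 0 T, c t ∈ Ω) :
    HasDerivAt (fun s : ℝ => ∫ t in (0 : ℝ)..T, g (c t + s • η t))
      (∫ t in (0 : ℝ)..T, fderiv ℝ g (c t) (η t)) 0 := by
  let c' : C(Icc (0 : ℝ) T, W) := ⟨fun t => c t, hc.domRestrict⟩
  let η' : C(Icc (0 : ℝ) T, W) := ⟨fun t => η t, hη.domRestrict⟩
  obtain ⟨G, hG, ε, hε, hball⟩ := exists_contDiff_eqOn_ball (m := 1) hΩ (by exact_mod_cast hg) c'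
    fun t => hmem t t.2
  have hG1 : ContDiff ℝ 1 G := by exact_mod_cast hG
  have hline : HasDerivAt (fun s : ℝ => c' + s • η') η' 0 := by
    simpa using ((hasDerivAt_id (0 : ℝ)).smul_const η').const_add c'
  have hsup := (hasStrictFDerivAt_superposition hG1 c').hasFDerivAt
  rw [show c' = c' + (0 : ℝ) • η' by simp] at hsup
  have hd := (integralCLM (V := V) hT).hasFDerivAt.comp_hasDerivAt (0 : ℝ)
    (HasFDerivAt.comp_hasDerivAt (0 : ℝ) hsup hline)
  refine (hd.congr_of_eventuallyEq ?_).congr_deriv ?_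
  · have hsmall : ∀ᶠ s : ℝ in 𝓝 0, ‖s • η'‖ < ε := by
      have : Tendsto (fun s : ℝ => ‖s • η'‖) (𝓝 0) (𝓝 ‖(0 : ℝ) • η'‖) :=
        Continuous.tendsto (by fun_prop) 0
      exact this.eventually (gt_mem_nhds (by simpa using hε))
    filter_upwards [hsmall] with s hs
    refine (integralCLM_eq hT _ fun t => (hball t).2 ?_).symm
    rw [Metric.mem_ball, dist_eq_norm]
    simpa [c', η'] using ((s • η').norm_coe_le_norm t).trans_lt hs
  · refine integralCLM_eq hT _ fun t => ?_
    have heq : G =ᶠ[𝓝 (c t)] g := (hball t).2.eventuallyEq_of_mem (Metric.ball_mem_nhds _ hε)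
    simp only [zero_smul, add_zero, pointwiseCLM_apply, fderivAlong_apply]
    rw [← heq.fderiv_eq]
    rfl

theorem fderiv_curry_left {X Y W : Type*} [NormedAddCommGroup X] [NormedSpace ℝ X]
    [NormedAddCommGroup Y] [NormedSpace ℝ Y] [NormedAddCommGroup W] [NormedSpace ℝ W]
    {g : X × Y → W} {a : X} {b : Y} (hg : DifferentiableAt ℝ g (a, b)) :
    fderiv ℝ (fun z => g (z, b)) a = fderiv ℝ g (a, b) ∘L ContinuousLinearMap.inl ℝ X Y :=
  (hg.hasFDerivAt.comp a (hasFDerivAt_prodMk_left a b)).fderiv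

theorem fderiv_curry_right {X Y W : Type*} [NormedAddCommGroup X] [NormedSpace ℝ X]
    [NormedAddCommGroup Y] [NormedSpace ℝ Y] [NormedAddCommGroup W] [NormedSpace ℝ W]
    {g : X × Y → W} {a : X} {b : Y} (hg : DifferentiableAt ℝ g (a, b)) :
    fderiv ℝ (fun z => g (a, z)) b = fderiv ℝ g (a, b) ∘L ContinuousLinearMap.inr ℝ X Y :=
  (hg.hasFDerivAt.comp b (hasFDerivAt_prodMk_right a b)).fderiv

variable {W : Type*} [NormedAddCommGroup W] [NormedSpace ℝ W]

theorem forall_hasDerivWithinAt_iff_integral_eq_zero (hT : 0 < T) {D : ℝ → W × W →L[ℝ] ℝ}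
    (hD : ContinuousOn D (Icc 0 T)) :
    (∀ t ∈ Icc 0 T, HasDerivWithinAt (fun s => D s ∘L ContinuousLinearMap.inr ℝ W W)
      (D t ∘L ContinuousLinearMap.inl ℝ W W) (Icc 0 T) t) ↔
    ∀ δ : ℝ → W, ContDiff ℝ ∞ δ → δ 0 = 0 → δ T = 0 →
      ∫ t in (0 : ℝ)..T, D t (δ t, deriv δ t) = 0 := by
  constructor
  · intro h δ hδ h0 h1
    have hδ' : Continuous (deriv δ) := hδ.continuous_deriv (by simp)
    rw [integral_eq_sub_of_hasDerivWithinAt_Icc hT.le (g := fun t => D t (0, δ t))]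
    · simp only [h0, h1, Prod.mk_zero_zero, map_zero, sub_zero]
    · refine fun t ht => ((h t ht).clm_apply
        ((hδ.differentiable (by simp)) t).hasDerivAt.hasDerivWithinAt).congr_deriv ?_
      simp [← map_add]
    · exact hD.clm_apply (hδ.continuous.prodMk hδ').continuousOn
  · intro h
    have hDl := hD.clm_comp (continuousOn_const (c := ContinuousLinearMap.inl ℝ W W))
    have hDr := hD.clm_comp (continuousOn_const (c := ContinuousLinearMap.inr ℝ W W))
    refine hasDerivWithinAt_of_integral_eq_zero hT hDr hDl fun ψ hψ h0 h1 => ?_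
    have hψ' : Continuous (deriv ψ) := hψ.continuous_deriv (by simp)
    ext e
    rw [ContinuousLinearMap.intervalIntegral_apply (uIcc_of_le hT.le ▸
      (hψ'.continuousOn.smul hDr).add (hψ.continuous.continuousOn.smul hDl)).intervalIntegrable]
    refine Eq.trans (integral_congr fun t _ => ?_) (h (fun t => ψ t • e)
      (hψ.smul contDiff_const) (by simp [h0]) (by simp [h1]))
    have hd : deriv (fun t => ψ t • e) t = deriv ψ t • e :=
      (((hψ.differentiable (by simp)) t).hasDerivAt.smul_const e).deriv
    have hsplit : (ψ t • e, deriv ψ t • e) = deriv ψ t • ((0 : W), e) + ψ t • (e, (0 : W)) := by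
      simp
    simp only [hd]
    rw [hsplit, map_add, map_smul, map_smul]
    rfl

variable {Λ : W → W → ℝ} {Ω : Set (W × W)} {w : ℝ → W}

theorem eulerLagrange_iff_hasDerivWithinAt
    (hΛ : ∀ t ∈ Icc 0 T, DifferentiableAt ℝ (fun p : W × W => Λ p.1 p.2)
      (w t, derivWithin w (Icc 0 T) t)) :
    EulerLagrange Λ T w ↔ ∀ t ∈ Icc 0 T, HasDerivWithinAt
      (fun s => fderiv ℝ (fun p : W × W => Λ p.1 p.2) (w s, derivWithin w (Icc 0 T) s) ∘L
        ContinuousLinearMap.inr ℝ W W)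
      (fderiv ℝ (fun p : W × W => Λ p.1 p.2) (w t, derivWithin w (Icc 0 T) t) ∘L
        ContinuousLinearMap.inl ℝ W W) (Icc 0 T) t := by
  refine forall₂_congr fun t ht => ?_
  rw [fderiv_curry_left (g := fun p : W × W => Λ p.1 p.2) (hΛ t ht)]
  have hmom := fun s hs => fderiv_curry_right (g := fun p : W × W => Λ p.1 p.2) (hΛ s hs)
  exact ⟨fun h => h.congr (fun s hs => (hmom s hs).symm) (hmom t ht).symm,
    fun h => h.congr hmom (hmom t ht)⟩

theorem isStationary_iff_integral_eq_zero [FiniteDimensional ℝ W] (hT : 0 < T) (hΩ : IsOpen Ω)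
    (hΛ : ContDiffOn ℝ 1 (fun p : W × W => Λ p.1 p.2) Ω) (hw : ContDiffOn ℝ 1 w (Icc 0 T))
    (hmem : ∀ t ∈ Icc 0 T, (w t, derivWithin w (Icc 0 T) t) ∈ Ω) :
    IsStationary Λ T w ↔ ∀ δ : ℝ → W, ContDiff ℝ ∞ δ → δ 0 = 0 → δ T = 0 →
      ∫ t in (0 : ℝ)..T, fderiv ℝ (fun p : W × W => Λ p.1 p.2)
        (w t, derivWithin w (Icc 0 T) t) (δ t, deriv δ t) = 0 := by
  have hUD := uniqueDiffOn_Icc hT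
  refine forall₂_congr fun δ hδ => forall₂_congr fun _ _ => ?_
  have hδ' : Continuous (deriv δ) := hδ.continuous_deriv (by simp)
  have hd := hasDerivAt_integral_comp_add_smul hT.le hΩ hΛ
    (hw.continuousOn.prodMk (hw.continuousOn_derivWithin hUD le_rfl))
    (hδ.continuous.prodMk hδ').continuousOn hmem
  have haction : ∀ s : ℝ, ∫ t in (0 : ℝ)..T,
      Λ (w t + s • δ t) (derivWithin (fun τ => w τ + s • δ τ) (Icc 0 T) t) =
      ∫ t in (0 : ℝ)..T, Λ (w t + s • δ t) (derivWithin w (Icc 0 T) t + s • deriv δ t) := by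
    refine fun s => integral_congr fun t ht => ?_
    rw [uIcc_of_le hT.le] at ht
    have h1 := (hw.differentiableOn one_ne_zero t ht).hasDerivWithinAt
    have h2 := (hδ.differentiable (by simp) t).hasDerivAt.hasDerivWithinAt (s := Icc 0 T)
    exact congrArg (Λ _) ((h1.add (h2.const_smul s)).derivWithin (hUD t ht))
  rw [funext haction]
  exact ⟨fun h => hd.unique h, fun h => hd.congr_deriv h⟩

theorem eulerLagrange_iff_isStationary [FiniteDimensional ℝ W] (hT : 0 < T) (hΩ : IsOpen Ω)
    (hΛ : ContDiffOn ℝ 1 (fun p : W × W => Λ p.1 p.2) Ω) (hw : ContDiffOn ℝ 1 w (Icc 0 T))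
    (hmem : ∀ t ∈ Icc 0 T, (w t, derivWithin w (Icc 0 T) t) ∈ Ω) :
    EulerLagrange Λ T w ↔ IsStationary Λ T w := by
  have hD := (hΛ.continuousOn_fderiv_of_isOpen hΩ le_rfl).comp
    (hw.continuousOn.prodMk (hw.continuousOn_derivWithin (uniqueDiffOn_Icc hT) le_rfl)) hmem
  rw [eulerLagrange_iff_hasDerivWithinAt fun t ht =>
      (hΛ.contDiffAt (hΩ.mem_nhds (hmem t ht))).differentiableAt one_ne_zero,
    isStationary_iff_integral_eq_zero hT hΩ hΛ hw hmem]
  exact forall_hasDerivWithinAt_iff_integral_eq_zero hT hD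

end CalculusOfVariations

section OneSidedDerivatives

variable {V W : Type*} [NormedAddCommGroup V] [NormedSpace ℝ V] [NormedAddCommGroup W]
  [NormedSpace ℝ W] {s : Set ℝ} {t : ℝ}

theorem hasDerivWithinAt_congr {f g : ℝ → V} {f' g' : V} (hfg : EqOn f g s) (hfg' : f' = g')
    (ht : t ∈ s) : HasDerivWithinAt f f' s t ↔ HasDerivWithinAt g g' s t :=
  hfg' ▸ ⟨fun h => h.congr hfg.symm (hfg ht).symm, fun h => h.congr hfg (hfg ht)⟩

theorem hasDerivWithinAt_zero_iff (ht : UniqueDiffWithinAt ℝ s t) {v : V} :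
    HasDerivWithinAt (fun _ => (0 : V)) v s t ↔ 0 = v :=
  ⟨fun h => ht.eq_deriv _ (hasDerivWithinAt_const t s 0) h,
    fun h => h ▸ hasDerivWithinAt_const t s 0⟩

theorem hasDerivWithinAt_clm_iff_basis {ι : Type*} [Finite ι] (b : Module.Basis ι ℝ W)
    {P : ℝ → W →L[ℝ] V} {P' : W →L[ℝ] V} :
    HasDerivWithinAt P P' s t ↔ ∀ i, HasDerivWithinAt (fun τ => P τ (b i)) (P' (b i)) s t := by
  refine ⟨fun h i => by simpa using h.clm_apply (hasDerivWithinAt_const t s (b i)), fun h => ?_⟩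
  cases nonempty_fintype ι
  have : FiniteDimensional ℝ W := Module.Finite.of_basis b
  let dual (i : ι) : V →L[ℝ] W →L[ℝ] V :=
    ContinuousLinearMap.smulRightL ℝ W V (LinearMap.toContinuousLinearMap (b.coord i))
  have hdual : ∀ φ : W →L[ℝ] V, φ = ∑ i, dual i (φ (b i)) := fun φ => by
    ext w
    conv_lhs => rw [← b.sum_repr w, map_sum]
    simp [dual, -Module.Basis.sum_repr]
  rw [hdual P', show P = fun τ => ∑ i, dual i (P τ (b i)) from funext fun τ => hdual (P τ)]
  exact HasDerivWithinAt.fun_sum fun i _ => (dual i).hasFDerivAt.comp_hasDerivWithinAt t (h i)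

end OneSidedDerivatives

section LagrangeMultiplier

open Filter Topology

variable {X C W Z : Type*} [NormedAddCommGroup X] [NormedSpace ℝ X] [NormedAddCommGroup C]
  [NormedSpace ℝ C] [NormedAddCommGroup W] [NormedSpace ℝ W] [NormedAddCommGroup Z]
  [NormedSpace ℝ Z] [CompleteSpace X] [CompleteSpace W] [FiniteDimensional ℝ Z]
  {F : X × C → W} {F' : X × C →L[ℝ] W} {κ : X × C → Z} {κ' : X × C →L[ℝ] Z}
  {φ : X × C → ℝ} {φ' : X × C →L[ℝ] ℝ} {c : X × C} {M : Submodule ℝ C}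

theorem not_isLocalExtrOn_of_rightInverse
    (hF : HasStrictFDerivAt F F' c) (hκ : HasStrictFDerivAt κ κ' c)
    (hφ : HasStrictFDerivAt φ φ' c) (hsurj : ∀ w, ∃ h, F' (h, 0) = w)
    (s : Z × ℝ →ₗ[ℝ] X × C) (hsM : ∀ k, (s k).2 ∈ M) (hsF : ∀ k, F' (s k) = 0)
    (hs : ∀ k, (κ' (s k), φ' (s k)) = k) :
    ¬IsLocalExtrOn φ {c' | c'.2 - c.2 ∈ M ∧ F c' = F c ∧ κ c' = κ c} c := by
  intro hextr
  -- The control variations reached by `s` span a finite-dimensional, hence complete, space.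
  let N : Submodule ℝ C := LinearMap.range (LinearMap.snd ℝ X C ∘ₗ s)
  have hNM : N ≤ M := by
    rintro _ ⟨k, rfl⟩
    exact hsM k
  let i : X × N →L[ℝ] X × C := (ContinuousLinearMap.id ℝ X).prodMap N.subtypeL
  have hi : HasStrictFDerivAt (fun e => c + i e) i 0 := i.hasStrictFDerivAt.const_add c
  have hi0 : c + i 0 = c := by rw [map_zero, add_zero]
  have hfF : HasStrictFDerivAt (fun e => (F (c + i e), κ (c + i e)))
      ((F' ∘L i).prod (κ' ∘L i)) 0 :=
    (HasStrictFDerivAt.comp 0 (by rwa [hi0]) hi).prodMk (HasStrictFDerivAt.comp 0 (by rwa [hi0]) hi)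
  have hfφ : HasStrictFDerivAt (fun e => φ (c + i e)) (φ' ∘L i) 0 :=
    HasStrictFDerivAt.comp 0 (by rwa [hi0]) hi
  have hextr_i : IsLocalExtrOn (fun e => φ (c + i e))
      {e | (F (c + i e), κ (c + i e)) = (F (c + i 0), κ (c + i 0))} 0 := by
    refine IsExtrFilter.comp_tendsto (l := 𝓝[{c' | c'.2 - c.2 ∈ M ∧ F c' = F c ∧ κ c' = κ c}] c)
      (g := fun e => c + i e) (by rwa [hi0]) (tendsto_nhdsWithin_iff.mpr ⟨?_, ?_⟩)
    · exact (hi.continuousAt.tendsto.mono_left nhdsWithin_le_nhds).trans_eq (by rw [hi0])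
    · filter_upwards [self_mem_nhdsWithin] with e he
      rw [hi0] at he
      exact ⟨by simpa [i] using hNM e.2.2, Prod.mk.inj he⟩
  refine hextr_i.range_ne_top_of_hasStrictFDerivAt hfF hfφ (LinearMap.range_eq_top.mpr ?_)
  rintro ⟨⟨w, k⟩, j⟩
  obtain ⟨h, hh⟩ := hsurj w
  obtain ⟨d, hd⟩ : ∃ d, d = (k, j) - (κ' (h, 0), φ' (h, 0)) := ⟨_, rfl⟩
  have hκφ : κ' (s d) = k - κ' (h, 0) ∧ φ' (s d) = j - φ' (h, 0) :=
    Prod.mk.inj ((hs d).trans hd)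
  refine ⟨(h + (s d).1, ⟨(s d).2, d, rfl⟩), ?_⟩
  have hsum : i (h + (s d).1, ⟨(s d).2, d, rfl⟩) = (h, 0) + s d := by ext <;> simp [i]
  simp [hsum, hh, hsF, hκφ.1, hκφ.2]

theorem exists_multiplier_of_isLocalExtrOn
    (hF : HasStrictFDerivAt F F' c) (hκ : HasStrictFDerivAt κ κ' c)
    (hφ : HasStrictFDerivAt φ φ' c) (hsurj : ∀ w, ∃ h, F' (h, 0) = w)
    (hextr : IsLocalExtrOn φ {c' | c'.2 - c.2 ∈ M ∧ F c' = F c ∧ κ c' = κ c} c) :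
    ∃ (p : Z →L[ℝ] ℝ) (p₀ : ℝ), (p₀ ≠ 0 ∨ p ≠ 0) ∧
      ∀ h, ∀ v ∈ M, F' (h, v) = 0 → p (κ' (h, v)) + p₀ * φ' (h, v) = 0 := by
  let S : Submodule ℝ (X × C) := LinearMap.ker F'.toLinearMap ⊓ M.comap (LinearMap.snd ℝ X C)
  let G : S →ₗ[ℝ] Z × ℝ := (κ'.prod φ').toLinearMap ∘ₗ S.subtype
  have hrange : LinearMap.range G ≠ ⊤ := by
    intro htop
    obtain ⟨s, hs⟩ := G.exists_rightInverse_of_surjective htop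
    exact not_isLocalExtrOn_of_rightInverse hF hκ hφ hsurj (S.subtype ∘ₗ s)
      (fun k => (s k).2.2) (fun k => (s k).2.1) (fun k => LinearMap.congr_fun hs k) hextr
  obtain ⟨ν, hν, hνG⟩ := Submodule.exists_le_ker_of_lt_top _ (lt_top_iff_ne_top.mpr hrange)
  have hsplit : ∀ (k : Z) (j : ℝ), ν (k, j) = ν (k, 0) + ν (0, 1) * j := fun k j => by
    rw [mul_comm, ← smul_eq_mul, ← map_smul, ← map_add]
    simp
  refine ⟨LinearMap.toContinuousLinearMap (ν ∘ₗ LinearMap.inl ℝ Z ℝ), ν (0, 1), ?_,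
    fun h v hv hhv => ?_⟩
  · by_contra! hcon
    refine hν (LinearMap.ext fun k => ?_)
    rw [← Prod.mk.eta (p := k), hsplit, hcon.1, zero_mul, add_zero]
    exact DFunLike.congr_fun hcon.2 k.1
  · have hker : ν (κ' (h, v), φ' (h, v)) = 0 := hνG ⟨⟨(h, v), hhv, hv⟩, rfl⟩
    rwa [hsplit] at hker

end LagrangeMultiplier

section Pontryagin

open Filter Topology MeasureTheory intervalIntegral

variable {Z U : Type*} [NormedAddCommGroup Z] [NormedSpace ℝ Z] [NormedAddCommGroup U]
  [NormedSpace ℝ U] {T : ℝ}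

/-- The curve `z` solves the control system `ż = f(z, u)` on `[0, T]`. -/
def IsTrajectory (f : Z × U → Z) (T : ℝ) (z : ℝ → Z) (u : ℝ → U) : Prop :=
  ∀ t ∈ Icc 0 T, HasDerivWithinAt z (f (z t, u t)) (Icc 0 T) t

/-- The trajectory `z'` with control `u + v` is a variation of `(z, u)` with the same end points,
smooth in the control, `ε`-close to `(z, u)` and with values in `Ω`. -/
structure IsControlVariation (Ω : Set (Z × U)) (f : Z × U → Z) (T ε : ℝ) (z : ℝ → Z) (u : ℝ → U)
    (z' : ℝ → Z) (v : ℝ → U) : Prop where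
  contDiff : ContDiff ℝ ∞ v
  mem : ∀ t ∈ Icc 0 T, (z' t, u t + v t) ∈ Ω
  isTrajectory : IsTrajectory f T z' (u + v)
  left_eq : z' 0 = z 0
  right_eq : z' T = z T
  close : ∀ t ∈ Icc 0 T, ‖z' t - z t‖ < ε ∧ ‖v t‖ < ε

/-- The control `u` with trajectory `z` is a local minimum or maximum of `∫₀ᵀ ℓ(z, u) dt` among
its smooth control variations. -/
def IsLocallyOptimalControl (Ω : Set (Z × U)) (f : Z × U → Z) (ℓ : Z × U → ℝ) (T : ℝ)
    (z : ℝ → Z) (u : ℝ → U) : Prop :=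
  ∃ ε > 0,
    (∀ z' v, IsControlVariation Ω f T ε z u z' v →
      ∫ t in (0 : ℝ)..T, ℓ (z t, u t) ≤ ∫ t in (0 : ℝ)..T, ℓ (z' t, u t + v t)) ∨
    (∀ z' v, IsControlVariation Ω f T ε z u z' v →
      ∫ t in (0 : ℝ)..T, ℓ (z' t, u t + v t) ≤ ∫ t in (0 : ℝ)..T, ℓ (z t, u t))

theorem IsLocallyOptimalControl.univ_of_eqOn_ball {Ω : Set (Z × U)} {f f' : Z × U → Z}
    {ℓ ℓ' : Z × U → ℝ} {z : ℝ → Z} {u : ℝ → U} (hT : 0 ≤ T) {ε : ℝ} (hε : 0 < ε)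
    (hΩ : ∀ t ∈ Icc 0 T, Metric.ball (z t, u t) ε ⊆ Ω)
    (hf : ∀ t ∈ Icc 0 T, EqOn f' f (Metric.ball (z t, u t) ε))
    (hℓ : ∀ t ∈ Icc 0 T, EqOn ℓ' ℓ (Metric.ball (z t, u t) ε))
    (hopt : IsLocallyOptimalControl Ω f ℓ T z u) : IsLocallyOptimalControl univ f' ℓ' T z u := by
  obtain ⟨δ, hδ, hext⟩ := hopt
  have hcost {z' : ℝ → Z} {u' : ℝ → U}
      (h : ∀ t ∈ Icc 0 T, (z' t, u' t) ∈ Metric.ball (z t, u t) ε) :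
      ∫ t in (0 : ℝ)..T, ℓ' (z' t, u' t) = ∫ t in (0 : ℝ)..T, ℓ (z' t, u' t) :=
    intervalIntegral.integral_congr fun t ht => by
      rw [uIcc_of_le hT] at ht
      exact hℓ t ht (h t ht)
  have hball {z' v} (h : IsControlVariation univ f' T (min δ ε) z u z' v) (t : ℝ)
      (ht : t ∈ Icc 0 T) : (z' t, u t + v t) ∈ Metric.ball (z t, u t) ε := by
    rw [mem_ball_iff_norm, Prod.mk_sub_mk, add_sub_cancel_left, Prod.norm_mk, max_lt_iff]
    exact (h.close t ht).imp (·.trans_le (min_le_right _ _)) (·.trans_le (min_le_right _ _))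
  have hvar {z' v} (h : IsControlVariation univ f' T (min δ ε) z u z' v) :
      IsControlVariation Ω f T δ z u z' v :=
    { h with
      mem := fun t ht => hΩ t ht (hball h t ht)
      isTrajectory := fun t ht => (h.isTrajectory t ht).congr_deriv (hf t ht (hball h t ht))
      close := fun t ht =>
        (h.close t ht).imp (·.trans_le (min_le_left _ _)) (·.trans_le (min_le_left _ _)) }
  have hcenter := hcost fun t _ => Metric.mem_ball_self hε
  refine ⟨min δ ε, lt_min hδ hε, hext.imp (fun hmin z' v h => ?_) fun hmax z' v h => ?_⟩
  · rw [hcenter, hcost (hball h)]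
    exact hmin z' v (hvar h)
  · rw [hcenter, hcost (hball h)]
    exact hmax z' v (hvar h)

/-- The covector `ξ` is a solution on `[0, T]` of Pontryagin's equations `ξ̇ = -∂H/∂z`,
`∂H/∂u = 0`, where `A` and `a` are the derivatives of the control system and of the running cost
along a curve, so that `ξ ∘ A + a` is the derivative of the Hamiltonian `H = ξ(f) + ℓ`. -/
structure IsAdjointCurve (A : ℝ → Z × U →L[ℝ] Z) (a : ℝ → Z × U →L[ℝ] ℝ) (T : ℝ)
    (ξ : ℝ → Z →L[ℝ] ℝ) : Prop where
  hasDerivWithinAt : ∀ t ∈ Icc 0 T, HasDerivWithinAt ξ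
    (-((ξ t ∘L A t + a t) ∘L ContinuousLinearMap.inl ℝ Z U)) (Icc 0 T) t
  stationary : ∀ t ∈ Icc 0 T, (ξ t ∘L A t + a t) ∘L ContinuousLinearMap.inr ℝ Z U = 0

variable {A : ℝ → Z × U →L[ℝ] Z} {a : ℝ → Z × U →L[ℝ] ℝ}

theorem IsAdjointCurve.const_smul {ξ : ℝ → Z →L[ℝ] ℝ} (h : IsAdjointCurve A a T ξ) (c : ℝ) :
    IsAdjointCurve A (c • a) T (c • ξ) where
  hasDerivWithinAt t ht := ((h.hasDerivWithinAt t ht).const_smul c).congr_deriv <| by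
    ext; simp
  stationary t ht := by
    have := congrArg (c • ·) (h.stationary t ht)
    simpa [← smul_add] using this

theorem IsAdjointCurve.congr {A' : ℝ → Z × U →L[ℝ] Z} {a' : ℝ → Z × U →L[ℝ] ℝ}
    {ξ : ℝ → Z →L[ℝ] ℝ} (h : IsAdjointCurve A a T ξ) (hA : EqOn A A' (Icc 0 T))
    (ha : EqOn a a' (Icc 0 T)) : IsAdjointCurve A' a' T ξ where
  hasDerivWithinAt t ht := hA ht ▸ ha ht ▸ h.hasDerivWithinAt t ht
  stationary t ht := hA ht ▸ ha ht ▸ h.stationary t ht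

/-- Concatenation of a continuous state curve and a continuous control curve. -/
def pairCLM (T : ℝ) (Z U : Type*) [NormedAddCommGroup Z] [NormedSpace ℝ Z] [NormedAddCommGroup U]
    [NormedSpace ℝ U] :
    C(Icc (0 : ℝ) T, Z) × C(Icc (0 : ℝ) T, U) →L[ℝ] C(Icc (0 : ℝ) T, Z × U) :=
  (ContinuousLinearMap.inl ℝ Z U).compLeftContinuous ℝ (Icc (0 : ℝ) T) ∘L
      ContinuousLinearMap.fst ℝ _ _ +
    (ContinuousLinearMap.inr ℝ Z U).compLeftContinuous ℝ (Icc (0 : ℝ) T) ∘L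
      ContinuousLinearMap.snd ℝ _ _

@[simp] theorem pairCLM_apply (c : C(Icc (0 : ℝ) T, Z) × C(Icc (0 : ℝ) T, U))
    (t : Icc (0 : ℝ) T) : pairCLM T Z U c t = (c.1 t, c.2 t) := by
  simp [pairCLM]

/-- The restrictions to `[0, T]` of smooth curves. -/
def smoothCurves (T : ℝ) (U : Type*) [NormedAddCommGroup U] [NormedSpace ℝ U] :
    Submodule ℝ C(Icc (0 : ℝ) T, U) where
  carrier := {v | ∃ v' : ℝ → U, ContDiff ℝ ∞ v' ∧ ∀ t : Icc (0 : ℝ) T, v t = v' t}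
  add_mem' := by
    rintro v w ⟨v', hv', hv⟩ ⟨w', hw', hw⟩
    exact ⟨fun t => v' t + w' t, hv'.add hw', fun t => by simp [hv, hw]⟩
  zero_mem' := ⟨fun _ => 0, contDiff_const, fun t => rfl⟩
  smul_mem' := by
    rintro c v ⟨v', hv', hv⟩
    exact ⟨fun t => c • v' t, hv'.const_smul c, fun t => by simp [hv]⟩

section AdjointEquation

theorem integral_stationary_eq [CompleteSpace Z] (hT : 0 ≤ T) (hA : ContinuousOn A (Icc 0 T))
    (ha : ContinuousOn a (Icc 0 T)) {ξ : ℝ → Z →L[ℝ] ℝ}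
    (hξ : ∀ t ∈ Icc 0 T, HasDerivWithinAt ξ
      (-((ξ t ∘L A t + a t) ∘L ContinuousLinearMap.inl ℝ Z U)) (Icc 0 T) t)
    {ζ : ℝ → Z} {v : ℝ → U} (hv : ContinuousOn v (Icc 0 T))
    (hζ : ∀ t ∈ Icc 0 T, HasDerivWithinAt ζ (A t (ζ t, v t)) (Icc 0 T) t) :
    ∫ t in (0 : ℝ)..T, (ξ t ∘L A t + a t) (0, v t) =
      ξ T (ζ T) - ξ 0 (ζ 0) + ∫ t in (0 : ℝ)..T, a t (ζ t, v t) := by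
  have hξc : ContinuousOn ξ (Icc 0 T) := fun t ht => (hξ t ht).continuousWithinAt
  have hζc : ContinuousOn ζ (Icc 0 T) := fun t ht => (hζ t ht).continuousWithinAt
  have hHc : ContinuousOn (fun t => (ξ t ∘L A t + a t) (0, v t)) (Icc 0 T) :=
    ((hξc.clm_comp hA).add ha).clm_apply (continuousOn_const.prodMk hv)
  have hac : ContinuousOn (fun t => a t (ζ t, v t)) (Icc 0 T) := ha.clm_apply (hζc.prodMk hv)
  have hFTC := integral_eq_sub_of_hasDerivWithinAt_Icc hT (g := fun t => ξ t (ζ t))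
    (g' := fun t => (ξ t ∘L A t + a t) (0, v t) - a t (ζ t, v t)) (fun t ht => by
      refine ((hξ t ht).clm_apply (hζ t ht)).congr_deriv ?_
      have hsplit : (ζ t, v t) = (ζ t, 0) + (0, v t) := by simp
      simp only [hsplit, map_add, neg_apply, add_apply, ContinuousLinearMap.comp_apply,
        ContinuousLinearMap.inl_apply]
      ring) (hHc.sub hac)
  rw [intervalIntegral.integral_sub (uIcc_of_le hT ▸ hHc).intervalIntegrable
    (uIcc_of_le hT ▸ hac).intervalIntegrable] at hFTC
  exact sub_eq_iff_eq_add.mp hFTC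

theorem exists_isAdjointCurve [CompleteSpace Z] (hT : 0 < T) (hA : ContinuousOn A (Icc 0 T))
    (ha : ContinuousOn a (Icc 0 T)) (p : Z →L[ℝ] ℝ)
    (hp : ∀ (ζ : ℝ → Z) (v : ℝ → U), ContDiff ℝ ∞ v → ζ 0 = 0 →
      (∀ t ∈ Icc 0 T, HasDerivWithinAt ζ (A t (ζ t, v t)) (Icc 0 T) t) →
      p (ζ T) + ∫ t in (0 : ℝ)..T, a t (ζ t, v t) = 0) :
    ∃ ξ, ξ T = p ∧ IsAdjointCurve A a T ξ := by
  have hA₁ : ContinuousOn (fun t => A t ∘L ContinuousLinearMap.inl ℝ Z U) (Icc 0 T) :=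
    hA.clm_comp continuousOn_const
  obtain ⟨ξ, hξT, hξ⟩ := exists_linear_terminal_value_solution hT.le
    ((ContinuousLinearMap.continuous
      (-(ContinuousLinearMap.compL ℝ Z Z ℝ).flip)).comp_continuousOn hA₁)
    ((ha.clm_comp (continuousOn_const (c := ContinuousLinearMap.inl ℝ Z U))).neg) p
  have hξ' : ∀ t ∈ Icc 0 T, HasDerivWithinAt ξ
      (-((ξ t ∘L A t + a t) ∘L ContinuousLinearMap.inl ℝ Z U)) (Icc 0 T) t := fun t ht =>
    (hξ t ht).congr_deriv (by ext; simp; ring)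
  have hξc : ContinuousOn ξ (Icc 0 T) := fun t ht => (hξ t ht).continuousWithinAt
  refine ⟨ξ, hξT, hξ', fun t ht => ContinuousLinearMap.ext fun e => ?_⟩
  refine eq_zero_of_integral_contDiff_smul_eq_zero hT
    (((hξc.clm_comp hA).add ha).clm_apply continuousOn_const) (fun ψ hψ _ _ => ?_) t ht
  have hψe : ContDiff ℝ ∞ fun t => ψ t • e := hψ.smul contDiff_const
  have hψec := hψe.continuous.continuousOn (s := Icc 0 T)
  obtain ⟨ζ, hζ0, hζ⟩ := exists_linear_ode_solution hT.le hA₁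
    ((hA.clm_comp (continuousOn_const (c := ContinuousLinearMap.inr ℝ Z U))).clm_apply hψec) 0
  have hζ' : ∀ t ∈ Icc 0 T, HasDerivWithinAt ζ (A t (ζ t, ψ t • e)) (Icc 0 T) t := fun t ht =>
    (hζ t ht).congr_deriv (by
      rw [ContinuousLinearMap.comp_apply, ContinuousLinearMap.comp_apply, ← map_add]
      simp)
  have hdual := integral_stationary_eq hT.le hA ha hξ' hψec hζ'
  rw [hξT, hζ0, map_zero, sub_zero, hp ζ _ hψe hζ0 hζ'] at hdual
  refine (integral_congr fun t _ => ?_).trans hdual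
  exact ((ξ t ∘L A t + a t).map_smul (ψ t) (0, e)).symm.trans
    (by rw [Prod.smul_mk, smul_zero])

end AdjointEquation

section CurveSpace

variable {f : Z × U → Z} {ℓ : Z × U → ℝ}

/-- The cost `∫₀ᵀ ℓ(z, u) dt` as a functional on pairs of curves. -/
def costFunctional (hT : 0 ≤ T) (hℓ : Continuous ℓ)
    (c : C(Icc (0 : ℝ) T, Z) × C(Icc (0 : ℝ) T, U)) : ℝ :=
  integralCLM hT (superposition hℓ (pairCLM T Z U c))

theorem hasStrictFDerivAt_costFunctional (hT : 0 ≤ T) (hℓ : ContDiff ℝ 1 ℓ)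
    (c : C(Icc (0 : ℝ) T, Z) × C(Icc (0 : ℝ) T, U)) :
    HasStrictFDerivAt (costFunctional hT hℓ.continuous)
      (integralCLM hT ∘L pointwiseCLM (fderivAlong hℓ (pairCLM T Z U c)) ∘L pairCLM T Z U) c :=
  (integralCLM hT).hasStrictFDerivAt.comp c
    ((hasStrictFDerivAt_superposition hℓ _).comp c (pairCLM T Z U).hasStrictFDerivAt)

variable [CompleteSpace Z]

/-- The defect `z - ∫₀ f(z, u)` of a pair of curves: it is constant exactly along the solutions of
the control system `ż = f(z, u)`. -/
def defect (hT : 0 ≤ T) (hf : Continuous f) (c : C(Icc (0 : ℝ) T, Z) × C(Icc (0 : ℝ) T, U)) :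
    C(Icc (0 : ℝ) T, Z) :=
  c.1 - primitiveCLM hT (superposition hf (pairCLM T Z U c))

theorem defect_eq_const_iff (hT : 0 ≤ T) (hf : Continuous f)
    {c : C(Icc (0 : ℝ) T, Z) × C(Icc (0 : ℝ) T, U)} {z : ℝ → Z} {u : ℝ → U}
    (hz : ∀ t : Icc (0 : ℝ) T, c.1 t = z t) (hu : ∀ t : Icc (0 : ℝ) T, c.2 t = u t) {z₀ : Z} :
    defect hT hf c = ContinuousMap.const _ z₀ ↔ z 0 = z₀ ∧ IsTrajectory f T z u := by
  rw [defect, sub_eq_iff_eq_add]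
  exact eq_const_add_primitiveCLM_iff hT hz fun t => by simp [hz, hu]

/-- The derivative of the defect, for the linearised control system `ζ̇ = A(ζ, v)`. -/
def linearisedDefect (hT : 0 ≤ T) (A : C(Icc (0 : ℝ) T, Z × U →L[ℝ] Z)) :
    C(Icc (0 : ℝ) T, Z) × C(Icc (0 : ℝ) T, U) →L[ℝ] C(Icc (0 : ℝ) T, Z) :=
  ContinuousLinearMap.fst ℝ _ _ - primitiveCLM hT ∘L pointwiseCLM A ∘L pairCLM T Z U

theorem linearisedDefect_eq_zero_iff (hT : 0 ≤ T) (A : C(Icc (0 : ℝ) T, Z × U →L[ℝ] Z))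
    {h : C(Icc (0 : ℝ) T, Z)} {v : C(Icc (0 : ℝ) T, U)} {A' : ℝ → Z × U →L[ℝ] Z} {ζ : ℝ → Z}
    {v' : ℝ → U} (hA : ∀ t : Icc (0 : ℝ) T, A t = A' t) (hζ : ∀ t : Icc (0 : ℝ) T, h t = ζ t)
    (hv : ∀ t : Icc (0 : ℝ) T, v t = v' t) :
    linearisedDefect hT A (h, v) = 0 ↔
      ζ 0 = 0 ∧ ∀ t ∈ Icc 0 T, HasDerivWithinAt ζ (A' t (ζ t, v' t)) (Icc 0 T) t := by
  rw [← eq_const_add_primitiveCLM_iff hT hζ (g := pointwiseCLM A (pairCLM T Z U (h, v)))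
    fun t => by simp [hA, hζ, hv]]
  exact sub_eq_zero.trans (by rw [show ContinuousMap.const _ (0 : Z) = 0 from rfl, zero_add]; rfl)

theorem exists_linearisedDefect_eq (hT : 0 ≤ T) (A : C(Icc (0 : ℝ) T, Z × U →L[ℝ] Z))
    (w : C(Icc (0 : ℝ) T, Z)) : ∃ h, linearisedDefect hT A (h, 0) = w := by
  obtain ⟨h, hh⟩ := exists_sub_volterra_eq hT
    (⟨fun t => A t ∘L ContinuousLinearMap.inl ℝ Z U, by fun_prop⟩ : C(Icc (0 : ℝ) T, Z →L[ℝ] Z)) w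
  refine ⟨h, hh ▸ congrArg (h - primitiveCLM hT ·) ?_⟩
  ext t
  simp

theorem hasStrictFDerivAt_defect (hT : 0 ≤ T) (hf : ContDiff ℝ 1 f)
    (c : C(Icc (0 : ℝ) T, Z) × C(Icc (0 : ℝ) T, U)) :
    HasStrictFDerivAt (defect hT hf.continuous)
      (linearisedDefect hT (fderivAlong hf (pairCLM T Z U c))) c :=
  hasStrictFDerivAt_fst.sub ((primitiveCLM hT).hasStrictFDerivAt.comp c
    ((hasStrictFDerivAt_superposition hf _).comp c (pairCLM T Z U).hasStrictFDerivAt))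

theorem exists_isControlVariation (hT : 0 ≤ T) (hf : Continuous f) (hℓ : Continuous ℓ)
    {c c' : C(Icc (0 : ℝ) T, Z) × C(Icc (0 : ℝ) T, U)} {z : ℝ → Z} {u : ℝ → U}
    (hz : ∀ t : Icc (0 : ℝ) T, c.1 t = z t) (hu : ∀ t : Icc (0 : ℝ) T, c.2 t = u t)
    (htraj : IsTrajectory f T z u) {ε : ℝ} (hclose : ‖c' - c‖ < ε)
    (hsmooth : c'.2 - c.2 ∈ smoothCurves T U) (hdefect : defect hT hf c' = defect hT hf c)
    (hright : c'.1 ⟨T, hT, le_rfl⟩ = c.1 ⟨T, hT, le_rfl⟩) :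
    ∃ z' v, IsControlVariation univ f T ε z u z' v ∧
      costFunctional hT hℓ c' = ∫ t in (0 : ℝ)..T, ℓ (z' t, u t + v t) := by
  obtain ⟨v, hv, hcv⟩ := hsmooth
  have hz' : ∀ t, c'.1 t = IccExtend hT c'.1 t := fun t => (IccExtend_val hT _ t).symm
  have hu' : ∀ t : Icc (0 : ℝ) T, c'.2 t = (u + v) t := fun t => by
    rw [Pi.add_apply, ← hu, ← hcv, ContinuousMap.sub_apply, add_sub_cancel]
  rw [(defect_eq_const_iff hT hf hz hu).mpr ⟨rfl, htraj⟩,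
    defect_eq_const_iff hT hf hz' hu'] at hdefect
  rw [Prod.norm_def, max_lt_iff] at hclose
  refine ⟨IccExtend hT c'.1, v, ⟨hv, fun _ _ => mem_univ _, hdefect.2, hdefect.1, ?_,
    fun t ht => ?_⟩, integralCLM_eq hT _ fun t => by simp [← hz', hu']⟩
  · rw [← hz ⟨T, hT, le_rfl⟩, ← hright, hz']
  · rw [← hz ⟨t, ht⟩, ← hz' ⟨t, ht⟩, ← hcv ⟨t, ht⟩]
    exact ⟨((c'.1 - c.1).norm_coe_le_norm _).trans_lt hclose.1,
      ((c'.2 - c.2).norm_coe_le_norm _).trans_lt hclose.2⟩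

theorem isLocalExtrOn_of_isLocallyOptimalControl (hT : 0 ≤ T) (hf : Continuous f)
    (hℓ : Continuous ℓ) {c : C(Icc (0 : ℝ) T, Z) × C(Icc (0 : ℝ) T, U)} {z : ℝ → Z} {u : ℝ → U}
    (hz : ∀ t : Icc (0 : ℝ) T, c.1 t = z t) (hu : ∀ t : Icc (0 : ℝ) T, c.2 t = u t)
    (htraj : IsTrajectory f T z u) (hopt : IsLocallyOptimalControl univ f ℓ T z u) :
    IsLocalExtrOn (costFunctional hT hℓ)
      {c' | c'.2 - c.2 ∈ smoothCurves T U ∧ defect hT hf c' = defect hT hf c ∧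
        c'.1 ⟨T, hT, le_rfl⟩ = c.1 ⟨T, hT, le_rfl⟩} c := by
  obtain ⟨ε, hε, hext⟩ := hopt
  have hcost : costFunctional hT hℓ c = ∫ t in (0 : ℝ)..T, ℓ (z t, u t) :=
    integralCLM_eq hT _ fun t => by simp [hz, hu]
  have hvar : ∀ᶠ c' in 𝓝[{c' | c'.2 - c.2 ∈ smoothCurves T U ∧
      defect hT hf c' = defect hT hf c ∧ c'.1 ⟨T, hT, le_rfl⟩ = c.1 ⟨T, hT, le_rfl⟩}] c,
      ∃ z' v, IsControlVariation univ f T ε z u z' v ∧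
        costFunctional hT hℓ c' = ∫ t in (0 : ℝ)..T, ℓ (z' t, u t + v t) := by
    filter_upwards [self_mem_nhdsWithin, mem_nhdsWithin_of_mem_nhds (Metric.ball_mem_nhds c hε)]
      with c' ⟨hsmooth, hdefect, hright⟩ hball
    exact exists_isControlVariation hT hf hℓ hz hu htraj (mem_ball_iff_norm.mp hball) hsmooth
      hdefect hright
  rcases hext with hmin | hmax
  · exact .inl (hvar.mono fun c' ⟨z', v, h, hc'⟩ => by
      rw [hcost, hc']
      exact hmin z' v h)
  · exact .inr (hvar.mono fun c' ⟨z', v, h, hc'⟩ => by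
      rw [hcost, hc']
      exact hmax z' v h)

end CurveSpace

variable [FiniteDimensional ℝ Z] {f : Z × U → Z} {ℓ : Z × U → ℝ} {z : ℝ → Z} {u : ℝ → U}

theorem exists_isAdjointCurve_of_contDiff (hT : 0 < T) (hf : ContDiff ℝ 1 f)
    (hℓ : ContDiff ℝ 1 ℓ) (hu : ContinuousOn u (Icc 0 T)) (hz : IsTrajectory f T z u)
    (hopt : IsLocallyOptimalControl univ f ℓ T z u) :
    ∃ (p₀ : ℝ) (ξ : ℝ → Z →L[ℝ] ℝ), (p₀ ≠ 0 ∨ ξ T ≠ 0) ∧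
      IsAdjointCurve (fun t => fderiv ℝ f (z t, u t)) (p₀ • fun t => fderiv ℝ ℓ (z t, u t)) T
        ξ := by
  have := FiniteDimensional.complete ℝ Z
  have hzc : ContinuousOn z (Icc 0 T) := fun t ht => (hz t ht).continuousWithinAt
  have hzu : ContinuousOn (fun t => (z t, u t)) (Icc 0 T) := hzc.prodMk hu
  let c : C(Icc (0 : ℝ) T, Z) × C(Icc (0 : ℝ) T, U) :=
    (⟨fun t => z t, hzc.domRestrict⟩, ⟨fun t => u t, hu.domRestrict⟩)
  have hcpair : ∀ t, pairCLM T Z U c t = (z t, u t) := fun t => pairCLM_apply c t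
  let evalT : C(Icc (0 : ℝ) T, Z) × C(Icc (0 : ℝ) T, U) →L[ℝ] Z :=
    ContinuousMap.evalCLM ℝ ⟨T, hT.le, le_rfl⟩ ∘L ContinuousLinearMap.fst ℝ _ _
  obtain ⟨p, p₀, hne, hann⟩ := exists_multiplier_of_isLocalExtrOn
    (hasStrictFDerivAt_defect hT.le hf c) (evalT.hasStrictFDerivAt (x := c))
    (hasStrictFDerivAt_costFunctional hT.le hℓ c) (exists_linearisedDefect_eq hT.le _)
    (isLocalExtrOn_of_isLocallyOptimalControl hT.le hf.continuous hℓ.continuous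
      (fun _ => rfl) (fun _ => rfl) hz hopt)
  obtain ⟨ξ, hξT, hξ⟩ := exists_isAdjointCurve hT
    ((hf.continuous_fderiv one_ne_zero).comp_continuousOn hzu)
    (((hℓ.continuous_fderiv one_ne_zero).comp_continuousOn hzu).const_smul p₀) p
    fun ζ v hv hζ0 hζ => by
      have hζc : ContinuousOn ζ (Icc 0 T) := fun t ht => (hζ t ht).continuousWithinAt
      let h : C(Icc (0 : ℝ) T, Z) := ⟨fun t => ζ t, hζc.domRestrict⟩
      let w : C(Icc (0 : ℝ) T, U) := ⟨fun t => v t, hv.continuous.continuousOn.domRestrict⟩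
      have hlin := (linearisedDefect_eq_zero_iff hT.le (fderivAlong hf (pairCLM T Z U c)) (h := h)
        (v := w) (fun t => by rw [fderivAlong_apply, hcpair]; rfl) (fun _ => rfl)
        fun _ => rfl).mpr ⟨hζ0, hζ⟩
      refine Eq.trans (congrArg (p (ζ T) + ·) ?_) (hann h w ⟨v, hv, fun _ => rfl⟩ hlin)
      simp only [Pi.smul_apply, smul_apply, smul_eq_mul, Function.comp_apply,
        intervalIntegral.integral_const_mul]
      exact congrArg (p₀ * ·) (integralCLM_eq hT.le
        (pointwiseCLM (fderivAlong hℓ (pairCLM T Z U c)) (pairCLM T Z U (h, w))) fun t => by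
          simp only [pointwiseCLM_apply, fderivAlong_apply, hcpair, pairCLM_apply]
          rfl).symm
  exact ⟨p₀, ξ, hξT ▸ hne, hξ⟩

theorem exists_isAdjointCurve_of_isLocallyOptimalControl [FiniteDimensional ℝ U]
    {Ω : Set (Z × U)} (hT : 0 < T) (hΩ : IsOpen Ω) (hf : ContDiffOn ℝ 1 f Ω)
    (hℓ : ContDiffOn ℝ 1 ℓ Ω) (hu : ContinuousOn u (Icc 0 T))
    (hmem : ∀ t ∈ Icc 0 T, (z t, u t) ∈ Ω) (hz : IsTrajectory f T z u)
    (hopt : IsLocallyOptimalControl Ω f ℓ T z u) :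
    ∃ (p₀ : ℝ) (ξ : ℝ → Z →L[ℝ] ℝ), (p₀ ≠ 0 ∨ ξ T ≠ 0) ∧
      IsAdjointCurve (fun t => fderiv ℝ f (z t, u t)) (p₀ • fun t => fderiv ℝ ℓ (z t, u t)) T
        ξ := by
  have hzc : ContinuousOn z (Icc 0 T) := fun t ht => (hz t ht).continuousWithinAt
  obtain ⟨g, hg, ε, hε, hball⟩ := exists_contDiff_eqOn_ball (m := 1) hΩ
    (mod_cast hf.prodMk hℓ) ⟨fun t : Icc (0 : ℝ) T => (z t, u t), (hzc.prodMk hu).domRestrict⟩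
    fun t => hmem t t.2
  have hfg : ∀ t ∈ Icc 0 T, EqOn (fun p => (g p).1) f (Metric.ball (z t, u t) ε) :=
    fun t ht p hp => congrArg Prod.fst ((hball ⟨t, ht⟩).2 hp)
  have hℓg : ∀ t ∈ Icc 0 T, EqOn (fun p => (g p).2) ℓ (Metric.ball (z t, u t) ε) :=
    fun t ht p hp => congrArg Prod.snd ((hball ⟨t, ht⟩).2 hp)
  obtain ⟨p₀, ξ, hne, hadj⟩ := exists_isAdjointCurve_of_contDiff hT (contDiff_fst.comp hg)
    (contDiff_snd.comp hg) hu
    (fun t ht => (hz t ht).congr_deriv (hfg t ht (Metric.mem_ball_self hε)).symm)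
    (hopt.univ_of_eqOn_ball hT.le hε (fun t ht => (hball ⟨t, ht⟩).1) hfg hℓg)
  refine ⟨p₀, ξ, hne, hadj.congr (fun t ht => ?_) fun t ht => ?_⟩
  · exact ((hfg t ht).eventuallyEq_of_mem (Metric.ball_mem_nhds _ hε)).fderiv_eq
  · have := ((hℓg t ht).eventuallyEq_of_mem (Metric.ball_mem_nhds _ hε)).fderiv_eq (𝕜 := ℝ)
    exact congrArg (p₀ • ·) this

end Pontryagin

section ControlSystems

variable {Z U : Type*} [NormedAddCommGroup Z] [NormedSpace ℝ Z] [NormedAddCommGroup U]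
  [NormedSpace ℝ U] {T : ℝ}

theorem IsTrajectory.contDiffOn (hT : 0 < T) {Ω : Set (Z × U)} {f : Z × U → Z}
    (hf : ContDiffOn ℝ ∞ f Ω) {z : ℝ → Z} {u : ℝ → U} {N : ℕ∞}
    (hu : ∀ j : ℕ, ((j + 1 : ℕ) : ℕ∞) ≤ N → ContDiffOn ℝ j u (Icc 0 T))
    (hmem : ∀ t ∈ Icc 0 T, (z t, u t) ∈ Ω) (hz : IsTrajectory f T z u) :
    ContDiffOn ℝ N z (Icc 0 T) := by
  have hnat : ∀ j : ℕ, (j : ℕ∞) ≤ N → ContDiffOn ℝ j z (Icc 0 T) := by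
    intro j
    induction j with
    | zero => exact fun _ => contDiffOn_zero.mpr fun t ht => (hz t ht).continuousWithinAt
    | succ j ih =>
      intro hj
      have hzj := ih (le_trans (mod_cast j.le_succ) hj)
      rw [Nat.cast_add, Nat.cast_one, contDiffOn_succ_iff_derivWithin (uniqueDiffOn_Icc hT)]
      refine ⟨fun t ht => (hz t ht).differentiableWithinAt, by simp, ?_⟩
      exact ((hf.of_le (mod_cast le_top)).comp (hzj.prodMk (hu j hj)) hmem).congr fun t ht =>
        (hz t ht).derivWithin (uniqueDiffOn_Icc hT t ht)
  induction N with
  | top => exact contDiffOn_infty.mpr fun j => hnat j le_top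
  | coe N => exact hnat N le_rfl

theorem IsAdjointCurve.contDiffOn {A : ℝ → Z × U →L[ℝ] Z} {a : ℝ → Z × U →L[ℝ] ℝ}
    {ξ : ℝ → Z →L[ℝ] ℝ} (h : IsAdjointCurve A a T ξ) (hT : 0 < T) (hA : ContinuousOn A (Icc 0 T))
    (ha : ContinuousOn a (Icc 0 T)) : ContDiffOn ℝ 1 ξ (Icc 0 T) := by
  have hξ : ContinuousOn ξ (Icc 0 T) := fun t ht => (h.hasDerivWithinAt t ht).continuousWithinAt
  rw [← zero_add (1 : WithTop ℕ∞), contDiffOn_succ_iff_derivWithin (uniqueDiffOn_Icc hT)]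
  refine ⟨fun t ht => (h.hasDerivWithinAt t ht).differentiableWithinAt, by simp, ?_⟩
  exact contDiffOn_zero.mpr ((((hξ.clm_comp hA).add ha).clm_comp continuousOn_const).neg.congr
    fun t ht => (h.hasDerivWithinAt t ht).derivWithin (uniqueDiffOn_Icc hT t ht))

-- Since the Hamiltonian is stationary in the control, the derivative of the feedback `κ` drops out.
theorem hasFDerivAt_cost_add_defect {P : Type*} [NormedAddCommGroup P] [NormedSpace ℝ P]
    {f : Z × U → Z} {ℓ : Z × U → ℝ} {ξ : Z →L[ℝ] ℝ} {σ ν : P → Z} {κ : P → U}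
    {σ' ν' : P →L[ℝ] Z} {p : P} {c : Z × U} (hc : (σ p, κ p) = c) (hf : DifferentiableAt ℝ f c)
    (hℓ : DifferentiableAt ℝ ℓ c) (hσ : HasFDerivAt σ σ' p) (hν : HasFDerivAt ν ν' p)
    (hκ : DifferentiableAt ℝ κ p)
    (hstat : (ξ ∘L fderiv ℝ f c - fderiv ℝ ℓ c) ∘L ContinuousLinearMap.inr ℝ Z U = 0) :
    HasFDerivAt (fun q => ℓ (σ q, κ q) + ξ (ν q - f (σ q, κ q)))
      (ξ ∘L ν' - (ξ ∘L fderiv ℝ f c - fderiv ℝ ℓ c) ∘L ContinuousLinearMap.inl ℝ Z U ∘L σ') p := by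
  subst hc
  have hpair := hσ.prodMk hκ.hasFDerivAt
  refine ((hℓ.hasFDerivAt.comp (f := fun q => (σ q, κ q)) p hpair).add (ξ.hasFDerivAt.comp p
    (hν.sub (hf.hasFDerivAt.comp (f := fun q => (σ q, κ q)) p hpair)))).congr_fderiv ?_
  ext v
  have hfeedback := congrArg (fun φ => φ (fderiv ℝ κ p v)) hstat
  have hsplit : (σ' v, fderiv ℝ κ p v) = (σ' v, 0) + (0, fderiv ℝ κ p v) := by simp
  simp only [ContinuousLinearMap.comp_apply, sub_apply, ContinuousLinearMap.inr_apply,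
    zero_apply] at hfeedback
  simp only [add_apply, ContinuousLinearMap.comp_apply, sub_apply, ContinuousLinearMap.prod_apply,
    ContinuousLinearMap.inl_apply, hsplit, map_add, map_sub]
  linarith

end ControlSystems

section LocalSmoothness

open Filter Topology

variable {n : ℕ} {Q : Type*} [TopologicalSpace Q] [ChartedSpace (EuclideanSpace ℝ (Fin n)) Q]
  [IsManifold (𝓡 n) ∞ Q]
  {F : Type*} [NormedAddCommGroup F] [NormedSpace ℝ F]
  {E : Q → Type*} [TopologicalSpace (TotalSpace F E)] [∀ q, TopologicalSpace (E q)]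
  [FiberBundle F E] [∀ q, AddCommGroup (E q)] [∀ q, Module ℝ (E q)] [VectorBundle ℝ F E]
  {𝒜 : LieAlgebroid n F E}

theorem LieAlgebroid.contMDiff_lieDeriv (𝒜 : LieAlgebroid n F E) {f : Q → ℝ}
    (hf : ContMDiff (𝓡 n) 𝓘(ℝ, ℝ) ∞ f) (X : Cₛ^∞⟮𝓡 n; F, E⟯) :
    ContMDiff (𝓡 n) 𝓘(ℝ, ℝ) ∞ (fun q => 𝒜.lieDeriv f q (X q)) := by
  have : IsManifold (𝓡 n) 1 Q := IsManifold.of_le (n := ∞) (by simp)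
  exact (contMDiff_snd_tangentBundle_modelSpace ℝ 𝓘(ℝ, ℝ)).comp
    ((hf.contMDiff_tangentMap (m := ∞) (by simp)).comp (𝒜.anchor_smooth X))

theorem contDiffOn_comp_chart_symm {n : ℕ} {Q : Type*} [TopologicalSpace Q]
    [ChartedSpace (EuclideanSpace ℝ (Fin n)) Q] {m : WithTop ℕ∞}
    {c : OpenPartialHomeomorph Q (EuclideanSpace ℝ (Fin n))}
    (hc : c ∈ IsManifold.maximalAtlas (𝓡 n) m Q) {W : Type*} [NormedAddCommGroup W]
    [NormedSpace ℝ W] {f : Q → W} (hf : ContMDiffOn (𝓡 n) 𝓘(ℝ, W) m f c.source) :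
    ContDiffOn ℝ m (fun x => f (c.symm x)) c.target :=
  contMDiffOn_iff_contDiffOn.mp
    (hf.comp (contMDiffOn_symm_of_mem_maximalAtlas hc) c.mapsTo_symm)

theorem contDiffOn_matrix_det {V ι : Type*} [NormedAddCommGroup V] [NormedSpace ℝ V] [Fintype ι]
    [DecidableEq ι] {m : WithTop ℕ∞} {M : V → Matrix ι ι ℝ} {s : Set V}
    (hM : ∀ i j, ContDiffOn ℝ m (fun x => M x i j) s) :
    ContDiffOn ℝ m (fun x => (M x).det) s := by
  simp only [Matrix.det_apply']
  exact ContDiffOn.sum fun σ _ => contDiffOn_const.mul (contDiffOn_prod fun l _ => hM _ _)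

theorem contDiffOn_matrix_inv {V ι : Type*} [NormedAddCommGroup V] [NormedSpace ℝ V] [Fintype ι]
    [DecidableEq ι] {m : WithTop ℕ∞} {M : V → Matrix ι ι ℝ} {s : Set V}
    (hM : ∀ i j, ContDiffOn ℝ m (fun x => M x i j) s) (hdet : ∀ x ∈ s, (M x).det ≠ 0) (i j : ι) :
    ContDiffOn ℝ m (fun x => (M x)⁻¹ i j) s := by
  simp only [Matrix.inv_def, Ring.inverse_eq_inv', Matrix.smul_apply, smul_eq_mul]
  refine ((contDiffOn_matrix_det hM).inv hdet).mul ?_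
  simp only [Matrix.adjugate_apply]
  refine contDiffOn_matrix_det fun a b => ?_
  by_cases ha : a = j
  · subst ha
    simpa only [Matrix.updateRow_self] using contDiffOn_const
  · simpa only [Matrix.updateRow_ne ha] using hM a b

namespace NonholonomicSystem

variable {m : ℕ} (S : NonholonomicSystem 𝒜 m)

theorem G_proj (q : Q) {v : E q} (hv : v ∈ S.D q) (w : E q) :
    S.G q v (S.proj q w) = S.G q v w := by
  have hmem : w - S.proj q w ∈ (S.G q).orthogonal (S.D q) := by
    refine (Submodule.projectionOnto_apply_eq_zero_iff (S.orthogonal_decomposition q)).mp ?_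
    rw [map_sub, sub_eq_zero]
    exact (Submodule.projectionOnto_apply_left (S.orthogonal_decomposition q) (S.proj q w)).symm
  have hzero : S.G q v (w - S.proj q w) = 0 := hmem v hv
  rw [map_sub, sub_eq_zero] at hzero
  exact hzero.symm

theorem contMDiff_koszul {X Y Z : Cₛ^∞⟮𝓡 n; F, E⟯} (hX : ∀ q, X q ∈ S.D q)
    (hY : ∀ q, Y q ∈ S.D q) (hZ : ∀ q, Z q ∈ S.D q) :
    ContMDiff (𝓡 n) 𝓘(ℝ, ℝ) ∞ (S.koszul X Y Z) := by
  have hbracket {X : Cₛ^∞⟮𝓡 n; F, E⟯} (hX : ∀ q, X q ∈ S.D q) (Y Z : Cₛ^∞⟮𝓡 n; F, E⟯) :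
      ContMDiff (𝓡 n) 𝓘(ℝ, ℝ) ∞ fun q => S.G q (X q) (S.bracketD Y Z q) := by
    simp only [bracketD, S.G_proj _ (hX _)]
    exact S.G_smooth X (𝒜.bracket Y Z)
  exact (((((𝒜.contMDiff_lieDeriv (S.G_smooth Y Z) X).add
    (𝒜.contMDiff_lieDeriv (S.G_smooth X Z) Y)).sub
    (𝒜.contMDiff_lieDeriv (S.G_smooth X Y) Z)).add (hbracket hX Z Y)).add (hbracket hY Z X)).sub
    (hbracket hZ Y X)

end NonholonomicSystem

namespace AdaptedFrame

variable {m : ℕ} {S : NonholonomicSystem 𝒜 m}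
  {Dc : ∀ q : Q, Submodule ℝ (E q)} {k r : ℕ} (fr : AdaptedFrame S Dc k r)

theorem gram_det_ne_zero {q : Q} (hq : q ∈ fr.chart.source) : (fr.gram q).det ≠ 0 := by
  intro hdet
  obtain ⟨v, hv, hv0⟩ := Matrix.exists_mulVec_eq_zero_iff.mpr hdet
  set d : E q := ∑ B, v B • fr.e B q with hd
  have hdD : d ∈ S.D q := Submodule.sum_mem _ fun B _ => Submodule.smul_mem _ _ (fr.e_mem B q)
  have hdo : d ∈ (S.G q).orthogonal (S.D q) := by
    intro w hw
    rw [← fr.span_eq q hq] at hw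
    refine Submodule.span_induction (p := fun w _ => S.G q w d = 0) ?_ (by simp) ?_ ?_ hw
    · rintro _ ⟨A, rfl⟩
      have := congrFun hv0 A
      simpa [Matrix.mulVec, dotProduct, gram, hd, mul_comm] using this
    · intro a b _ _ ha hb
      simp [ha, hb]
    · intro c a _ ha
      simp [ha]
  have hd0 : d = 0 := Submodule.disjoint_def.mp (S.orthogonal_decomposition q).disjoint d hdD hdo
  exact hv (funext fun B =>
    Fintype.linearIndependent_iff.mp (fr.linearIndependent q hq) v hd0 B)

theorem contDiffOn_gram (A B : Fin k ⊕ Fin r) :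
    ContDiffOn ℝ ∞ (fun x => fr.gram (fr.chart.symm x) A B) fr.chart.target :=
  contDiffOn_comp_chart_symm fr.chart_mem (S.G_smooth (fr.e A) (fr.e B)).contMDiffOn

theorem contDiffOn_gram_inv (A B : Fin k ⊕ Fin r) :
    ContDiffOn ℝ ∞ (fun x => (fr.gram (fr.chart.symm x))⁻¹ A B) fr.chart.target :=
  contDiffOn_matrix_inv fr.contDiffOn_gram
    (fun _ hx => fr.gram_det_ne_zero (fr.chart.map_target hx)) A B

theorem contDiffOn_christoffel (C A B : Fin k ⊕ Fin r) :
    ContDiffOn ℝ ∞ (fun x => fr.christoffel (fr.chart.symm x) C A B) fr.chart.target := by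
  refine ContDiffOn.sum fun K _ => (fr.contDiffOn_gram_inv C K).mul (ContDiffOn.div_const ?_ 2)
  exact contDiffOn_comp_chart_symm fr.chart_mem
    (S.contMDiff_koszul (fr.e_mem A) (fr.e_mem B) (fr.e_mem K)).contMDiffOn

theorem contDiffOn_gradV (C : Fin k ⊕ Fin r) :
    ContDiffOn ℝ ∞ (fun x => fr.gradV (fr.chart.symm x) C) fr.chart.target := by
  refine ContDiffOn.sum fun B _ => (fr.contDiffOn_gram_inv C B).mul ?_
  exact contDiffOn_comp_chart_symm fr.chart_mem
    (𝒜.contMDiff_lieDeriv S.V_smooth (fr.e B)).contMDiffOn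

theorem contDiffOn_rho (i : Fin n) (A : Fin k ⊕ Fin r) :
    ContDiffOn ℝ ∞ (fun x => fr.rho x i A) fr.chart.target := by
  have : IsManifold (𝓡 n) 1 Q := IsManifold.of_le (n := ∞) (by simp)
  have htangent := ((contMDiffOn_of_mem_maximalAtlas fr.chart_mem).contMDiffOn_tangentMapWithin
    (m := ∞) (by simp) fr.chart.open_source.uniqueMDiffOn).comp
    (𝒜.anchor_smooth (fr.e A)).contMDiffOn (s := fr.chart.source) fun _ hq => hq
  have hanchor : ContMDiffOn (𝓡 n) 𝓘(ℝ, EuclideanSpace ℝ (Fin n)) ∞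
      (fun q => fr.anchorCoord q (fr.e A q)) fr.chart.source := by
    refine ((contMDiff_snd_tangentBundle_modelSpace (EuclideanSpace ℝ (Fin n))
      (𝓡 n)).comp_contMDiffOn htangent).congr fun q hq => ?_
    simp only [Function.comp, tangentMapWithin, anchorCoord]
    rw [mfderivWithin_of_isOpen fr.chart.open_source hq]
  exact contDiffOn_euclidean.mp (contDiffOn_comp_chart_symm fr.chart_mem hanchor) i

theorem anchorCoord_vec (x : EuclideanSpace ℝ (Fin n)) (y : Fin k ⊕ Fin r → ℝ) (i : Fin n) :
    fr.anchorCoord (fr.chart.symm x) (fr.vec (fr.chart.symm x) y) i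
      = ∑ A, fr.rho x i A * y A := by
  let anchor_i : E (fr.chart.symm x) →ₗ[ℝ] ℝ := (EuclideanSpace.proj i).toLinearMap ∘ₗ
    (mfderiv (𝓡 n) (𝓡 n) fr.chart (fr.chart.symm x) :
      TangentSpace (𝓡 n) (fr.chart.symm x) →L[ℝ] EuclideanSpace ℝ (Fin n)).toLinearMap ∘ₗ
    𝒜.anchor (fr.chart.symm x)
  change anchor_i (fr.vec (fr.chart.symm x) y) = ∑ A, anchor_i (fr.e A (fr.chart.symm x)) * y A
  simp only [vec, Submodule.coe_sum, Submodule.coe_smul, map_sum, map_smul, smul_eq_mul, mul_comm]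

end AdaptedFrame

end LocalSmoothness

/-- Coordinates `(q, y)` of the points of `D`. -/
abbrev State (n k r : ℕ) : Type :=
  EuclideanSpace ℝ (Fin n) × (Fin k ⊕ Fin r → ℝ)

/-- Coordinates `(q, y, ẏ)`, the arguments of `𝓛` and of `F^C`. -/
abbrev Jet (n k r : ℕ) : Type :=
  EuclideanSpace ℝ (Fin n) × (Fin k ⊕ Fin r → ℝ) × (Fin k ⊕ Fin r → ℝ)

/-- Coordinates together with multipliers `(q, y, λ, λ̄)`, the configurations of the extended
Lagrangian. -/
abbrev ExtendedState (n k r : ℕ) : Type :=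
  EuclideanSpace ℝ (Fin n) × (Fin k ⊕ Fin r → ℝ) × (Fin n → ℝ) × (Fin r → ℝ)

namespace AdaptedFrame

variable {n : ℕ} {Q : Type*} [TopologicalSpace Q] [ChartedSpace (EuclideanSpace ℝ (Fin n)) Q]
  [IsManifold (𝓡 n) ∞ Q]
  {F : Type*} [NormedAddCommGroup F] [NormedSpace ℝ F]
  {E : Q → Type*} [TopologicalSpace (TotalSpace F E)] [∀ q, TopologicalSpace (E q)]
  [FiberBundle F E] [∀ q, AddCommGroup (E q)] [∀ q, Module ℝ (E q)] [VectorBundle ℝ F E]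
  {𝒜 : LieAlgebroid n F E} {m : ℕ} {S : NonholonomicSystem 𝒜 m}
  {Dc : ∀ q : Q, Submodule ℝ (E q)} {k r : ℕ} (fr : AdaptedFrame S Dc k r)
  {𝒰 : Set (Fin k → ℝ)} {cost : (q : Q) → S.D q → (Fin k → ℝ) → ℝ} {T : ℝ}

section Smoothness

theorem force_eq_add (x : EuclideanSpace ℝ (Fin n)) (y yd : Fin k ⊕ Fin r → ℝ)
    (C : Fin k ⊕ Fin r) : fr.force x y yd C = yd C + fr.force x y 0 C := by
  simp [force, add_assoc]

theorem contDiffOn_force (C : Fin k ⊕ Fin r) :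
    ContDiffOn ℝ ∞ (fun p : Jet n k r => fr.force p.1 p.2.1 p.2.2 C)
      (fr.chart.target ×ˢ univ) := by
  have hbase : ∀ {g : EuclideanSpace ℝ (Fin n) → ℝ}, ContDiffOn ℝ ∞ g fr.chart.target →
      ContDiffOn ℝ ∞ (fun p : Jet n k r => g p.1) (fr.chart.target ×ˢ univ) := fun hg =>
    hg.comp contDiff_fst.contDiffOn fun _ hp => hp.1
  refine ContDiffOn.add (ContDiffOn.add (by fun_prop) ?_) (hbase (fr.contDiffOn_gradV C))
  exact ContDiffOn.sum fun A _ => ContDiffOn.sum fun B _ =>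
    ((hbase (fr.contDiffOn_christoffel C A B)).mul (by fun_prop)).mul (by fun_prop)

theorem contDiffOn_actuatedForce :
    ContDiffOn ℝ ∞ (fun p : Jet n k r => fun c : Fin k => fr.force p.1 p.2.1 p.2.2 (Sum.inl c))
      (fr.chart.target ×ˢ univ) :=
  contDiffOn_pi.mpr fun c => fr.contDiffOn_force (Sum.inl c)

/-- The domain of the Lagrangian: states in the chart domain whose controls lie in `𝒰`. -/
def lagrangianDomain (𝒰 : Set (Fin k → ℝ)) : Set (Jet n k r) :=
  (fr.chart.target ×ˢ univ) ∩
    (fun p => fun c : Fin k => fr.force p.1 p.2.1 p.2.2 (Sum.inl c)) ⁻¹' 𝒰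

theorem isOpen_lagrangianDomain (h𝒰 : IsOpen 𝒰) : IsOpen (fr.lagrangianDomain 𝒰) :=
  fr.contDiffOn_actuatedForce.continuousOn.isOpen_inter_preimage
    (fr.chart.open_target.prod isOpen_univ) h𝒰

theorem contDiffOn_lagrangian (hcost : fr.SmoothCost 𝒰 cost) :
    ContDiffOn ℝ ∞ (fun p : Jet n k r => fr.lagrangian cost p.1 p.2.1 p.2.2)
      (fr.lagrangianDomain 𝒰) :=
  ContDiffOn.comp hcost (t := fr.chart.target ×ˢ univ ×ˢ 𝒰)
    (contDiff_fst.contDiffOn.prodMk ((contDiff_fst.comp contDiff_snd).contDiffOn.prodMk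
      (fr.contDiffOn_actuatedForce.mono inter_subset_left)))
    fun _ hp => ⟨hp.1.1, mem_univ _, hp.2⟩

/-- The domain of the extended Lagrangian, as a set of pairs `(w, ẇ)`. -/
def extendedDomain (𝒰 : Set (Fin k → ℝ)) : Set (ExtendedState n k r × ExtendedState n k r) :=
  (fun p => (p.1.1, p.1.2.1, p.2.2.1)) ⁻¹' fr.lagrangianDomain 𝒰

theorem isOpen_extendedDomain (h𝒰 : IsOpen 𝒰) : IsOpen (fr.extendedDomain 𝒰) :=
  (fr.isOpen_lagrangianDomain h𝒰).preimage (by fun_prop)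

theorem contDiffOn_extendedLagrangian (hcost : fr.SmoothCost 𝒰 cost) :
    ContDiffOn ℝ ∞ (fun p : ExtendedState n k r × ExtendedState n k r =>
      fr.extendedLagrangian cost p.1 p.2) (fr.extendedDomain 𝒰) := by
  have hjet : ContDiff ℝ ∞ (fun p : ExtendedState n k r × ExtendedState n k r =>
      ((p.1.1, p.1.2.1, p.2.2.1) : Jet n k r)) := by fun_prop
  refine ContDiffOn.add (ContDiffOn.add ?_ ?_) ?_
  · exact (fr.contDiffOn_lagrangian hcost).comp hjet.contDiffOn fun p hp => hp
  · refine ContDiffOn.sum fun i _ => ContDiffOn.mul (by fun_prop) (ContDiffOn.sub (by fun_prop) ?_)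
    refine ContDiffOn.sum fun A _ => ContDiffOn.mul ?_ (by fun_prop)
    exact (fr.contDiffOn_rho i A).comp (contDiff_fst.comp contDiff_fst).contDiffOn
      fun p hp => hp.1.1
  · refine ContDiffOn.sum fun α _ => ContDiffOn.mul (by fun_prop) ?_
    exact (fr.contDiffOn_force (Sum.inr α)).comp hjet.contDiffOn fun p hp => hp.1

end Smoothness

section PartialDerivatives

theorem differentiableAt_rho {x : EuclideanSpace ℝ (Fin n)} (hx : x ∈ fr.chart.target)
    (i : Fin n) (A : Fin k ⊕ Fin r) : DifferentiableAt ℝ (fun z => fr.rho z i A) x :=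
  ((fr.contDiffOn_rho i A).contDiffAt (fr.chart.open_target.mem_nhds hx)).differentiableAt
    (by simp)

theorem differentiableAt_Phi_base {x : EuclideanSpace ℝ (Fin n)} (hx : x ∈ fr.chart.target)
    (y yd : Fin k ⊕ Fin r → ℝ) (α : Fin r) : DifferentiableAt ℝ (fun z => fr.Phi α z y yd) x :=
  DifferentiableAt.comp (f := fun z => ((z, y, yd) : Jet n k r)) x
    (((fr.contDiffOn_force (Sum.inr α)).contDiffAt ((fr.chart.open_target.prod
      isOpen_univ).mem_nhds ⟨hx, mem_univ (y, yd)⟩)).differentiableAt (by simp)) (by fun_prop)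

theorem hasFDerivAt_force_fibre (x : EuclideanSpace ℝ (Fin n)) (y yd : Fin k ⊕ Fin r → ℝ)
    (C : Fin k ⊕ Fin r) :
    HasFDerivAt (fun w => fr.force x w yd C) (∑ A, (∑ B,
      (fr.christoffel (fr.chart.symm x) C A B + fr.christoffel (fr.chart.symm x) C B A) * y B) •
        ContinuousLinearMap.proj (R := ℝ) (φ := fun _ : Fin k ⊕ Fin r => ℝ) A) y := by
  refine HasFDerivAt.congr_fderiv (HasFDerivAt.add_const _ (HasFDerivAt.const_add _
    (HasFDerivAt.fun_sum fun A _ => HasFDerivAt.fun_sum fun B _ =>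
      ((hasFDerivAt_apply A y).const_mul _).mul (hasFDerivAt_apply B y)))) ?_
  ext v
  simp only [sum_apply, add_apply, smul_apply, ContinuousLinearMap.proj_apply, smul_eq_mul,
    Finset.sum_add_distrib, Finset.sum_mul, add_mul]
  rw [add_comm, Finset.sum_comm (f := fun A B => _ * y A * v B)]
  exact congrArg₂ (· + ·) (Finset.sum_congr rfl fun A _ => Finset.sum_congr rfl fun B _ => by ring)
    (Finset.sum_congr rfl fun A _ => Finset.sum_congr rfl fun B _ => by ring)

theorem differentiableAt_lagrangian (h𝒰 : IsOpen 𝒰) (hcost : fr.SmoothCost 𝒰 cost)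
    {p : Jet n k r} (hp : p ∈ fr.lagrangianDomain 𝒰) :
    DifferentiableAt ℝ (fun p : Jet n k r => fr.lagrangian cost p.1 p.2.1 p.2.2) p :=
  ((fr.contDiffOn_lagrangian hcost).contDiffAt
    ((fr.isOpen_lagrangianDomain h𝒰).mem_nhds hp)).differentiableAt (by simp)

theorem differentiableAt_extendedLagrangian (h𝒰 : IsOpen 𝒰) (hcost : fr.SmoothCost 𝒰 cost)
    {p : ExtendedState n k r × ExtendedState n k r} (hp : p ∈ fr.extendedDomain 𝒰) :
    DifferentiableAt ℝ (fun p : ExtendedState n k r × ExtendedState n k r =>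
      fr.extendedLagrangian cost p.1 p.2) p :=
  ((fr.contDiffOn_extendedLagrangian hcost).contDiffAt
    ((fr.isOpen_extendedDomain h𝒰).mem_nhds hp)).differentiableAt (by simp)

variable {x xd : EuclideanSpace ℝ (Fin n)} {y yd : Fin k ⊕ Fin r → ℝ} {l ld : Fin n → ℝ}
  {lb lbd : Fin r → ℝ}

theorem fderiv_extendedLagrangian_velocity (h𝒰 : IsOpen 𝒰) (hcost : fr.SmoothCost 𝒰 cost)
    (hdom : (x, y, yd) ∈ fr.lagrangianDomain 𝒰) (e : ExtendedState n k r) :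
    fderiv ℝ (fun v => fr.extendedLagrangian cost (x, y, l, lb) v) (xd, yd, ld, lbd) e
      = fderiv ℝ (fun v => fr.lagrangian cost x y v) yd e.2.1 + ∑ i, l i * e.1 i
        + ∑ α, lb α * e.2.1 (Sum.inr α) := by
  have hL : DifferentiableAt ℝ (fun v => fr.lagrangian cost x y v) yd :=
    (fr.differentiableAt_lagrangian h𝒰 hcost hdom).comp (f := fun v => (x, y, v)) yd
      (by fun_prop)
  have hfibre : HasFDerivAt (fun v : ExtendedState n k r => v.2.1)
      (ContinuousLinearMap.fst ℝ _ _ ∘L ContinuousLinearMap.snd ℝ _ _) (xd, yd, ld, lbd) :=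
    hasFDerivAt_snd.fst
  have hbase : ∀ i, HasFDerivAt (fun v : ExtendedState n k r => v.1 i)
      (EuclideanSpace.proj i ∘L ContinuousLinearMap.fst ℝ _ _) (xd, yd, ld, lbd) := fun i =>
    (EuclideanSpace.proj (𝕜 := ℝ) i).hasFDerivAt.comp (xd, yd, ld, lbd) hasFDerivAt_fst
  have hΦ : ∀ α, HasFDerivAt (fun v => fr.Phi α x y v)
      (ContinuousLinearMap.proj (R := ℝ) (φ := fun _ : Fin k ⊕ Fin r => ℝ) (Sum.inr α)) yd :=
    fun α => ((hasFDerivAt_apply (Sum.inr α) yd).add_const _).add_const _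
  have hsum := ((hL.hasFDerivAt.comp (xd, yd, ld, lbd) hfibre).add
    (HasFDerivAt.fun_sum fun i (_ : i ∈ Finset.univ) =>
      ((hbase i).sub_const (∑ A, fr.rho x i A * y A)).const_mul (l i))).add
    (HasFDerivAt.fun_sum fun α (_ : α ∈ Finset.univ) =>
      ((hΦ α).comp (xd, yd, ld, lbd) hfibre).const_mul (lb α))
  refine (congrArg (fun φ => φ e) (HasFDerivAt.fderiv hsum)).trans ?_
  simp

theorem differentiableAt_extendedLagrangian_position (h𝒰 : IsOpen 𝒰)
    (hcost : fr.SmoothCost 𝒰 cost) (hdom : (x, y, yd) ∈ fr.lagrangianDomain 𝒰) :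
    DifferentiableAt ℝ (fun z => fr.extendedLagrangian cost z (xd, yd, ld, lbd)) (x, y, l, lb) :=
  (fr.differentiableAt_extendedLagrangian h𝒰 hcost (p := ((x, y, l, lb), (xd, yd, ld, lbd)))
    hdom).comp (f := fun z => (z, (xd, yd, ld, lbd))) (x, y, l, lb) (by fun_prop)

theorem fderiv_extendedLagrangian_base (h𝒰 : IsOpen 𝒰) (hcost : fr.SmoothCost 𝒰 cost)
    (hdom : (x, y, yd) ∈ fr.lagrangianDomain 𝒰) (a : EuclideanSpace ℝ (Fin n)) :
    fderiv ℝ (fun z => fr.extendedLagrangian cost z (xd, yd, ld, lbd)) (x, y, l, lb) (a, 0)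
      = fderiv ℝ (fun z => fr.lagrangian cost z y yd) x a
        - ∑ j, ∑ A, l j * fderiv ℝ (fun z => fr.rho z j A) x a * y A
        + ∑ α, lb α * fderiv ℝ (fun z => fr.Phi α z y yd) x a := by
  have hx : x ∈ fr.chart.target := hdom.1.1
  have hL : DifferentiableAt ℝ (fun z => fr.lagrangian cost z y yd) x :=
    (fr.differentiableAt_lagrangian h𝒰 hcost hdom).comp (f := fun z => (z, y, yd)) x (by fun_prop)
  have hsum := (hL.hasFDerivAt.add (HasFDerivAt.fun_sum fun i (_ : i ∈ Finset.univ) =>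
      ((HasFDerivAt.fun_sum fun A (_ : A ∈ Finset.univ) =>
        (fr.differentiableAt_rho hx i A).hasFDerivAt.mul_const (y A)).const_sub
          (xd i)).const_mul (l i))).add
    (HasFDerivAt.fun_sum fun α (_ : α ∈ Finset.univ) =>
      (fr.differentiableAt_Phi_base hx y yd α).hasFDerivAt.const_mul (lb α))
  have hrestrict := fderiv_curry_left (fr.differentiableAt_extendedLagrangian_position
    (xd := xd) (ld := ld) (lbd := lbd) (l := l) (lb := lb) h𝒰 hcost hdom)
  refine (congrArg (fun φ => φ a) (hrestrict.symm.trans (HasFDerivAt.fderiv hsum))).trans ?_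
  simp only [add_apply, sum_apply, smul_apply, neg_apply, smul_eq_mul, mul_neg, Finset.mul_sum,
    Finset.sum_neg_distrib, ← sub_eq_add_neg]
  refine congrArg (_ - · + _) (Finset.sum_congr rfl fun j _ => Finset.sum_congr rfl fun A _ => ?_)
  ring

theorem fderiv_extendedLagrangian_fibre (h𝒰 : IsOpen 𝒰) (hcost : fr.SmoothCost 𝒰 cost)
    (hdom : (x, y, yd) ∈ fr.lagrangianDomain 𝒰) (A : Fin k ⊕ Fin r) :
    fderiv ℝ (fun z => fr.extendedLagrangian cost z (xd, yd, ld, lbd)) (x, y, l, lb)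
        (0, Pi.single A 1, 0)
      = fderiv ℝ (fun w => fr.lagrangian cost x w yd) y (Pi.single A 1)
        - ∑ i, l i * fr.rho x i A
        + ∑ α, lb α * ∑ B, (fr.christoffel (fr.chart.symm x) (Sum.inr α) A B
          + fr.christoffel (fr.chart.symm x) (Sum.inr α) B A) * y B := by
  have hL : DifferentiableAt ℝ (fun w => fr.lagrangian cost x w yd) y :=
    (fr.differentiableAt_lagrangian h𝒰 hcost hdom).comp (f := fun w => (x, w, yd)) y (by fun_prop)
  have hsum := (hL.hasFDerivAt.add (HasFDerivAt.fun_sum fun i (_ : i ∈ Finset.univ) =>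
      ((HasFDerivAt.fun_sum fun A (_ : A ∈ Finset.univ) =>
        (hasFDerivAt_apply A y).const_mul (fr.rho x i A)).const_sub (xd i)).const_mul (l i))).add
    (HasFDerivAt.fun_sum fun α (_ : α ∈ Finset.univ) =>
      (fr.hasFDerivAt_force_fibre x y yd (Sum.inr α)).const_mul (lb α))
  have hrestrict := (fr.differentiableAt_extendedLagrangian_position (xd := xd) (ld := ld)
    (lbd := lbd) (l := l) (lb := lb) h𝒰 hcost hdom).hasFDerivAt.comp y
    (HasFDerivAt.comp (f := fun w => (w, l, lb)) y (hasFDerivAt_prodMk_right x (y, l, lb))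
      (hasFDerivAt_prodMk_left y (l, lb)))
  refine (congrArg (fun φ => φ (Pi.single A 1)) (hrestrict.unique hsum)).trans ?_
  simp [Pi.single_apply, sub_eq_add_neg, -Fintype.sum_sum_type]

theorem fderiv_extendedLagrangian_multiplier (h𝒰 : IsOpen 𝒰) (hcost : fr.SmoothCost 𝒰 cost)
    (hdom : (x, y, yd) ∈ fr.lagrangianDomain 𝒰) (c : Fin n → ℝ) (d : Fin r → ℝ) :
    fderiv ℝ (fun z => fr.extendedLagrangian cost z (xd, yd, ld, lbd)) (x, y, l, lb) (0, 0, c, d)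
      = ∑ i, c i * (xd i - ∑ A, fr.rho x i A * y A) + ∑ α, d α * fr.Phi α x y yd := by
  have hsum : HasFDerivAt (fun μ : (Fin n → ℝ) × (Fin r → ℝ) => fr.lagrangian cost x y yd
      + ∑ i, μ.1 i * (xd i - ∑ A, fr.rho x i A * y A) + ∑ α, μ.2 α * fr.Phi α x y yd) _ (l, lb) :=
    ((HasFDerivAt.fun_sum fun i (_ : i ∈ Finset.univ) =>
      (ContinuousLinearMap.proj i ∘L ContinuousLinearMap.fst ℝ (Fin n → ℝ)
        (Fin r → ℝ)).hasFDerivAt.mul_const _).const_add _).add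
    (HasFDerivAt.fun_sum fun α (_ : α ∈ Finset.univ) =>
      (ContinuousLinearMap.proj α ∘L ContinuousLinearMap.snd ℝ (Fin n → ℝ)
        (Fin r → ℝ)).hasFDerivAt.mul_const _)
  have hrestrict := (fr.differentiableAt_extendedLagrangian_position (xd := xd) (ld := ld)
    (lbd := lbd) (l := l) (lb := lb) h𝒰 hcost hdom).hasFDerivAt.comp (l, lb)
    (HasFDerivAt.comp (f := fun μ => (y, μ)) (l, lb) (hasFDerivAt_prodMk_right x (y, l, lb))
      (hasFDerivAt_prodMk_right y (l, lb)))
  refine (congrArg (fun φ => φ (c, d)) (hrestrict.unique hsum)).trans ?_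
  simp [mul_comm]

end PartialDerivatives

section Equations

variable {x : ℝ → EuclideanSpace ℝ (Fin n)} {y : ℝ → Fin k ⊕ Fin r → ℝ}
  {lam : ℝ → Fin n → ℝ} {lamBar : ℝ → Fin r → ℝ}

theorem derivWithin_extended (hT : 0 < T) (hx : ContDiffOn ℝ 1 x (Icc 0 T))
    (hy : ContDiffOn ℝ 1 y (Icc 0 T)) (hl : ContDiffOn ℝ 1 lam (Icc 0 T))
    (hlb : ContDiffOn ℝ 1 lamBar (Icc 0 T)) {t : ℝ} (ht : t ∈ Icc 0 T) :
    derivWithin (fun t => (x t, y t, lam t, lamBar t)) (Icc 0 T) t =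
      (derivWithin x (Icc 0 T) t, derivWithin y (Icc 0 T) t, derivWithin lam (Icc 0 T) t,
        derivWithin lamBar (Icc 0 T) t) :=
  ((hx.differentiableOn one_ne_zero t ht).hasDerivWithinAt.prodMk
    ((hy.differentiableOn one_ne_zero t ht).hasDerivWithinAt.prodMk
      ((hl.differentiableOn one_ne_zero t ht).hasDerivWithinAt.prodMk
        (hlb.differentiableOn one_ne_zero t ht).hasDerivWithinAt))).derivWithin
    (uniqueDiffOn_Icc hT t ht)

theorem hasDerivWithinAt_extended_clm_iff {s : Set ℝ} {t : ℝ}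
    {P : ℝ → ExtendedState n k r →L[ℝ] ℝ} {P' : ExtendedState n k r →L[ℝ] ℝ} :
    HasDerivWithinAt P P' s t ↔
      (∀ i, HasDerivWithinAt (fun τ => P τ (EuclideanSpace.single i 1, 0))
        (P' (EuclideanSpace.single i 1, 0)) s t) ∧
      (∀ A, HasDerivWithinAt (fun τ => P τ (0, Pi.single A 1, 0))
        (P' (0, Pi.single A 1, 0)) s t) ∧
      (∀ i, HasDerivWithinAt (fun τ => P τ (0, 0, Pi.single i 1, 0))
        (P' (0, 0, Pi.single i 1, 0)) s t) ∧
      (∀ α, HasDerivWithinAt (fun τ => P τ (0, 0, 0, Pi.single α 1))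
        (P' (0, 0, 0, Pi.single α 1)) s t) := by
  rw [hasDerivWithinAt_clm_iff_basis ((EuclideanSpace.basisFun (Fin n) ℝ).toBasis.prod
    ((Pi.basisFun ℝ (Fin k ⊕ Fin r)).prod
      ((Pi.basisFun ℝ (Fin n)).prod (Pi.basisFun ℝ (Fin r)))))]
  rw [Sum.forall, Sum.forall (α := Fin k ⊕ Fin r), Sum.forall (α := Fin n)]
  simp only [Module.Basis.prod_apply, Sum.elim_inl, Sum.elim_inr, Function.comp_apply,
    LinearMap.inl_apply, LinearMap.inr_apply, Pi.basisFun_apply, OrthonormalBasis.coe_toBasis,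
    EuclideanSpace.basisFun_apply]

theorem eulerLagrange_extendedLagrangian_iff (h𝒰 : IsOpen 𝒰) (hcost : fr.SmoothCost 𝒰 cost)
    (hT : 0 < T) (hx : ContDiffOn ℝ 1 x (Icc 0 T)) (hy : ContDiffOn ℝ 1 y (Icc 0 T))
    (hl : ContDiffOn ℝ 1 lam (Icc 0 T)) (hlb : ContDiffOn ℝ 1 lamBar (Icc 0 T))
    (hdom : ∀ t ∈ Icc 0 T, (x t, y t, derivWithin y (Icc 0 T) t) ∈ fr.lagrangianDomain 𝒰) :
    EulerLagrange (fr.extendedLagrangian cost) T (fun t => (x t, y t, lam t, lamBar t)) ↔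
      ∀ t ∈ Icc 0 T,
        (∀ i, HasDerivWithinAt (fun s => lam s i)
          (fderiv ℝ (fun z => fr.lagrangian cost z (y t) (derivWithin y (Icc 0 T) t)) (x t)
              (EuclideanSpace.single i 1)
            - ∑ j, ∑ A, lam t j
                * fderiv ℝ (fun z => fr.rho z j A) (x t) (EuclideanSpace.single i 1) * y t A
            + ∑ α, lamBar t α
                * fderiv ℝ (fun z => fr.Phi α z (y t) (derivWithin y (Icc 0 T) t)) (x t)
                    (EuclideanSpace.single i 1)) (Icc 0 T) t) ∧
        (∀ A, HasDerivWithinAt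
          (fun s => fderiv ℝ (fun v => fr.lagrangian cost (x s) (y s) v)
            (derivWithin y (Icc 0 T) s) (Pi.single A 1) + Sum.elim (0 : Fin k → ℝ) (lamBar s) A)
          (fderiv ℝ (fun w => fr.lagrangian cost (x t) w (derivWithin y (Icc 0 T) t)) (y t)
              (Pi.single A 1)
            - ∑ i, lam t i * fr.rho (x t) i A
            + ∑ α, lamBar t α * ∑ B,
                (fr.christoffel (fr.chart.symm (x t)) (Sum.inr α) A B
                  + fr.christoffel (fr.chart.symm (x t)) (Sum.inr α) B A) * y t B)
          (Icc 0 T) t) ∧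
        (∀ i, 0 = derivWithin x (Icc 0 T) t i - ∑ A, fr.rho (x t) i A * y t A) ∧
        (∀ α, 0 = fr.Phi α (x t) (y t) (derivWithin y (Icc 0 T) t)) := by
  have hvelocity : ∀ e : ExtendedState n k r, ∀ s ∈ Icc 0 T,
      fderiv ℝ (fun v => fr.extendedLagrangian cost (x s, y s, lam s, lamBar s) v)
          (derivWithin (fun t => (x t, y t, lam t, lamBar t)) (Icc 0 T) s) e
        = fderiv ℝ (fun v => fr.lagrangian cost (x s) (y s) v) (derivWithin y (Icc 0 T) s) e.2.1
          + ∑ i, lam s i * e.1 i + ∑ α, lamBar s α * e.2.1 (Sum.inr α) := fun e s hs => by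
    rw [derivWithin_extended hT hx hy hl hlb hs]
    exact fr.fderiv_extendedLagrangian_velocity h𝒰 hcost (hdom s hs) e
  refine forall₂_congr fun t ht => ?_
  rw [hasDerivWithinAt_extended_clm_iff, derivWithin_extended hT hx hy hl hlb ht]
  have hunique := uniqueDiffOn_Icc hT t ht
  refine and_congr (forall_congr' fun i => hasDerivWithinAt_congr (fun s hs => ?_)
      (fr.fderiv_extendedLagrangian_base h𝒰 hcost (hdom t ht) _) ht)
    (and_congr (forall_congr' fun A => hasDerivWithinAt_congr (fun s hs => ?_)
      (fr.fderiv_extendedLagrangian_fibre h𝒰 hcost (hdom t ht) A) ht)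
    (and_congr (forall_congr' fun i => (hasDerivWithinAt_congr (fun s hs => ?_) ?_ ht).trans
      (hasDerivWithinAt_zero_iff hunique))
    (forall_congr' fun α => (hasDerivWithinAt_congr (fun s hs => ?_) ?_ ht).trans
      (hasDerivWithinAt_zero_iff hunique))))
  · simp [hvelocity _ s hs]
  · rcases A with a | α <;> simp [hvelocity _ s hs, Pi.single_apply]
  · simp [hvelocity _ s hs]
  · simp [fr.fderiv_extendedLagrangian_multiplier h𝒰 hcost (hdom t ht), Pi.single_apply]
  · simp [hvelocity _ s hs]
  · simp [fr.fderiv_extendedLagrangian_multiplier h𝒰 hcost (hdom t ht), Pi.single_apply]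

theorem necessaryConditions_iff_eulerLagrange (h𝒰 : IsOpen 𝒰) (hcost : fr.SmoothCost 𝒰 cost)
    (hT : 0 < T) (hx : ContDiffOn ℝ 1 x (Icc 0 T)) (hy : ContDiffOn ℝ 1 y (Icc 0 T))
    (hl : ContDiffOn ℝ 1 lam (Icc 0 T)) (hlb : ContDiffOn ℝ 1 lamBar (Icc 0 T))
    (hdom : ∀ t ∈ Icc 0 T, (x t, y t, derivWithin y (Icc 0 T) t) ∈ fr.lagrangianDomain 𝒰) :
    fr.NecessaryConditions (fr.lagrangian cost) T x y lam lamBar ↔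
      EulerLagrange (fr.extendedLagrangian cost) T (fun t => (x t, y t, lam t, lamBar t)) := by
  rw [fr.eulerLagrange_extendedLagrangian_iff h𝒰 hcost hT hx hy hl hlb hdom]
  have hlam (i t) (ht : t ∈ Icc 0 T) :=
    ((contDiffOn_pi.mp hl i).differentiableOn one_ne_zero t ht).hasDerivWithinAt
  have hlamBar (α t) (ht : t ∈ Icc 0 T) :=
    ((contDiffOn_pi.mp hlb α).differentiableOn one_ne_zero t ht).hasDerivWithinAt
  have hunique := uniqueDiffOn_Icc hT
  constructor
  · intro h t ht
    refine ⟨fun i => (hlam i t ht).congr_deriv (by linarith [h.base_eq t ht i]),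
      Sum.forall.mpr ⟨fun a => ?_, fun α => ?_⟩, h.admissible t ht, h.constraint t ht⟩
    · refine ((h.momentum_regular _ t ht).hasDerivWithinAt.add_const _).congr_deriv ?_
      have hact := h.actuated_eq t ht a
      simp only [mul_comm (fr.rho _ _ _)] at hact
      linarith
    · refine ((h.momentum_regular _ t ht).hasDerivWithinAt.add (hlamBar α t ht)).congr_deriv ?_
      linarith [h.unactuated_eq t ht α]
  · intro h
    have hact (a t) (ht : t ∈ Icc 0 T) :=
      (hasDerivWithinAt_add_const_iff 0).mp ((h t ht).2.1 (Sum.inl a))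
    have hunact (α t) (ht : t ∈ Icc 0 T) :=
      (hasDerivWithinAt_congr (fun s _ => add_sub_cancel_right _ (lamBar s α)) rfl ht).mp
        (((h t ht).2.1 (Sum.inr α)).sub (hlamBar α t ht))
    refine ⟨hl, hlb, Sum.forall.mpr ⟨fun a t ht => (hact a t ht).differentiableWithinAt,
        fun α t ht => (hunact α t ht).differentiableWithinAt⟩, fun t ht i => ?_, fun t ht a => ?_,
      fun t ht α => ?_, fun t ht => (h t ht).2.2.1, fun t ht => (h t ht).2.2.2⟩
    · rw [((h t ht).1 i).derivWithin (hunique t ht)]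
      ring
    · rw [(hact a t ht).derivWithin (hunique t ht)]
      simp only [mul_comm (fr.rho _ _ _)]
      ring
    · rw [(hunact α t ht).derivWithin (hunique t ht)]
      ring

theorem necessaryConditions_iff_isStationary (h𝒰 : IsOpen 𝒰) (hcost : fr.SmoothCost 𝒰 cost)
    (hT : 0 < T) (hx : ContDiffOn ℝ 1 x (Icc 0 T)) (hy : ContDiffOn ℝ 1 y (Icc 0 T))
    (hl : ContDiffOn ℝ 1 lam (Icc 0 T)) (hlb : ContDiffOn ℝ 1 lamBar (Icc 0 T))
    (hdom : ∀ t ∈ Icc 0 T, (x t, y t, derivWithin y (Icc 0 T) t) ∈ fr.lagrangianDomain 𝒰) :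
    fr.NecessaryConditions (fr.lagrangian cost) T x y lam lamBar ↔
      IsStationary (fr.extendedLagrangian cost) T (fun t => (x t, y t, lam t, lamBar t)) :=
  (fr.necessaryConditions_iff_eulerLagrange h𝒰 hcost hT hx hy hl hlb hdom).trans <|
    eulerLagrange_iff_isStationary hT (fr.isOpen_extendedDomain h𝒰)
      ((fr.contDiffOn_extendedLagrangian hcost).of_le (by simp))
      (hx.prodMk (hy.prodMk (hl.prodMk hlb))) fun t ht => by
        rw [derivWithin_extended hT hx hy hl hlb ht]
        exact hdom t ht

end Equations

section ControlSystem

/-- The equations of motion solved for the velocities: the control system `q̇ = ρ(q) y`,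
`ẏ^a = u^a - …`, `ẏ^α = - …` on `D`. -/
def controlField (p : State n k r × (Fin k → ℝ)) : State n k r :=
  (WithLp.toLp 2 fun i => ∑ A, fr.rho p.1.1 i A * p.1.2 A,
    fun C => Sum.elim p.2 0 C - fr.force p.1.1 p.1.2 0 C)

/-- The cost as a function of state and control. -/
def runningCost (cost : (q : Q) → S.D q → (Fin k → ℝ) → ℝ) (p : State n k r × (Fin k → ℝ)) : ℝ :=
  fr.localCost cost p.1.1 p.1.2 p.2

/-- The domain of the control problem: states in the chart domain with controls in `𝒰`. -/
def controlDomain (𝒰 : Set (Fin k → ℝ)) : Set (State n k r × (Fin k → ℝ)) :=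
  (fr.chart.target ×ˢ univ) ×ˢ 𝒰

theorem isOpen_controlDomain (h𝒰 : IsOpen 𝒰) : IsOpen (fr.controlDomain 𝒰) :=
  (fr.chart.open_target.prod isOpen_univ).prod h𝒰

theorem contDiffOn_controlField : ContDiffOn ℝ ∞ fr.controlField (fr.controlDomain 𝒰) := by
  refine ContDiffOn.prodMk (contDiffOn_euclidean.mpr fun i => ?_) (contDiffOn_pi.mpr fun C => ?_)
  · change ContDiffOn ℝ ∞ (fun p : State n k r × (Fin k → ℝ) => ∑ A, fr.rho p.1.1 i A * p.1.2 A) _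
    exact ContDiffOn.sum fun A _ => ContDiffOn.mul ((fr.contDiffOn_rho i A).comp
      (contDiff_fst.comp contDiff_fst).contDiffOn fun p hp => hp.1.1) (by fun_prop)
  · refine ContDiffOn.sub (by rcases C with c | α <;> dsimp only [Sum.elim] <;> fun_prop) ?_
    exact (fr.contDiffOn_force C).comp (f := fun p : State n k r × (Fin k → ℝ) =>
      (p.1.1, p.1.2, 0)) (by fun_prop) fun p hp => ⟨hp.1.1, mem_univ _⟩

theorem contDiffOn_runningCost (hcost : fr.SmoothCost 𝒰 cost) :
    ContDiffOn ℝ ∞ (fr.runningCost cost) (fr.controlDomain 𝒰) :=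
  ContDiffOn.comp hcost (t := fr.chart.target ×ˢ univ ×ˢ 𝒰)
    (f := fun p : State n k r × (Fin k → ℝ) => (p.1.1, p.1.2, p.2)) (by fun_prop)
    fun _ hp => ⟨hp.1.1, mem_univ _, hp.2⟩

theorem differentiableAt_controlField (h𝒰 : IsOpen 𝒰) {p : State n k r × (Fin k → ℝ)}
    (hp : p ∈ fr.controlDomain 𝒰) : DifferentiableAt ℝ fr.controlField p :=
  (fr.contDiffOn_controlField.contDiffAt
    ((fr.isOpen_controlDomain h𝒰).mem_nhds hp)).differentiableAt (by simp)

theorem differentiableAt_runningCost (h𝒰 : IsOpen 𝒰) (hcost : fr.SmoothCost 𝒰 cost)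
    {p : State n k r × (Fin k → ℝ)} (hp : p ∈ fr.controlDomain 𝒰) :
    DifferentiableAt ℝ (fr.runningCost cost) p :=
  ((fr.contDiffOn_runningCost hcost).contDiffAt
    ((fr.isOpen_controlDomain h𝒰).mem_nhds hp)).differentiableAt (by simp)

theorem fderiv_controlField_control (h𝒰 : IsOpen 𝒰) {p : State n k r × (Fin k → ℝ)}
    (hp : p ∈ fr.controlDomain 𝒰) (v : Fin k → ℝ) :
    fderiv ℝ fr.controlField p (0, v) = (0, Sum.elim v 0) := by
  have hline : HasDerivAt (fun s : ℝ => p + s • ((0, v) : State n k r × (Fin k → ℝ))) (0, v) 0 := by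
    simpa using ((hasDerivAt_id (0 : ℝ)).smul_const (0, v)).const_add p
  have haffine : (fun s : ℝ => fr.controlField (p + s • (0, v))) =
      fun s => fr.controlField p + s • ((0, Sum.elim v 0) : State n k r) := by
    funext s
    refine Prod.ext (by simp [controlField]) (funext fun C => ?_)
    rcases C with c | α <;> simp [controlField, sub_add_eq_add_sub]
  have hcomp := HasFDerivAt.comp_hasDerivAt_of_eq (0 : ℝ)
    (fr.differentiableAt_controlField h𝒰 hp).hasFDerivAt hline (by simp)
  refine hcomp.unique ?_
  rw [Function.comp_def, haffine]
  simpa using ((hasDerivAt_id (0 : ℝ)).smul_const ((0, Sum.elim v 0) : State n k r)).const_add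
    (fr.controlField p)

end ControlSystem

section Multipliers

/-- The multipliers `λ_i` of the admissibility constraints carried by a covector. -/
def baseMultiplier (ξ : State n k r →L[ℝ] ℝ) : Fin n → ℝ :=
  fun i => ξ (EuclideanSpace.single i 1, 0)

/-- The multipliers `λ̄_α` of the dynamical constraints `Φ^α` carried by a covector. -/
def constraintMultiplier (ξ : State n k r →L[ℝ] ℝ) : Fin r → ℝ :=
  fun α => ξ (0, Pi.single (Sum.inr α) 1)

theorem covector_apply_eq_sum (ξ : State n k r →L[ℝ] ℝ) (v : State n k r) :
    ξ v = ∑ i, baseMultiplier ξ i * v.1 i + ∑ a, ξ (0, Pi.single (Sum.inl a) 1) * v.2 (Sum.inl a)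
      + ∑ α, constraintMultiplier ξ α * v.2 (Sum.inr α) := by
  let b := (EuclideanSpace.basisFun (Fin n) ℝ).toBasis.prod (Pi.basisFun ℝ (Fin k ⊕ Fin r))
  conv_lhs => rw [← b.sum_repr v, map_sum]
  simp [b, baseMultiplier, constraintMultiplier, mul_comm, add_assoc, -Module.Basis.sum_repr]

end Multipliers

section AdjointIdentity

theorem extendedLagrangian_eq_runningCost_add (ξ : State n k r →L[ℝ] ℝ)
    (x xd : EuclideanSpace ℝ (Fin n)) (y yd : Fin k ⊕ Fin r → ℝ) (ld : Fin n → ℝ)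
    (lbd : Fin r → ℝ) :
    fr.extendedLagrangian cost (x, y, baseMultiplier ξ, constraintMultiplier ξ) (xd, yd, ld, lbd)
      = fr.runningCost cost ((x, y), fun c => fr.force x y yd (Sum.inl c))
        + ξ ((xd, yd) - fr.controlField ((x, y), fun c => fr.force x y yd (Sum.inl c))) := by
  rw [covector_apply_eq_sum]
  simp [extendedLagrangian, lagrangian, runningCost, controlField, Phi, add_assoc,
    fr.force_eq_add x y yd, -Fintype.sum_sum_type]

/-- The projection of configurations onto coordinates of `D`, forgetting the multipliers. -/
def statePart (n k r : ℕ) : ExtendedState n k r →L[ℝ] State n k r :=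
  (ContinuousLinearMap.fst ℝ _ _).prod
    (ContinuousLinearMap.fst ℝ _ _ ∘L ContinuousLinearMap.snd ℝ _ _)

variable {x xd : EuclideanSpace ℝ (Fin n)} {y yd : Fin k ⊕ Fin r → ℝ} {ld : Fin n → ℝ}
  {lbd : Fin r → ℝ} {u : Fin k → ℝ} {ξ : State n k r →L[ℝ] ℝ}

theorem mem_lagrangianDomain_of_mem_controlDomain (hp : ((x, y), u) ∈ fr.controlDomain 𝒰)
    (hu : (fun c => fr.force x y yd (Sum.inl c)) = u) : (x, y, yd) ∈ fr.lagrangianDomain 𝒰 := by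
  subst hu
  exact hp

theorem fderiv_extendedLagrangian_velocity_of_stationary (h𝒰 : IsOpen 𝒰)
    (hcost : fr.SmoothCost 𝒰 cost) (hp : ((x, y), u) ∈ fr.controlDomain 𝒰)
    (hu : (fun c => fr.force x y yd (Sum.inl c)) = u)
    (hstat : (ξ ∘L fderiv ℝ fr.controlField ((x, y), u)
      - fderiv ℝ (fr.runningCost cost) ((x, y), u)) ∘L
        ContinuousLinearMap.inr ℝ (State n k r) (Fin k → ℝ) = 0) :
    fderiv ℝ (fun v => fr.extendedLagrangian cost
        (x, y, baseMultiplier ξ, constraintMultiplier ξ) v) (xd, yd, ld, lbd)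
      = ξ ∘L statePart n k r := by
  have hκ : DifferentiableAt ℝ (fun v : ExtendedState n k r => fun c : Fin k =>
      fr.force x y v.2.1 (Sum.inl c)) (xd, yd, ld, lbd) := by
    unfold force
    fun_prop
  have henvelope := hasFDerivAt_cost_add_defect (p := ((xd, yd, ld, lbd) : ExtendedState n k r))
    (σ := fun _ => (x, y)) (κ := fun v => fun c => fr.force x y v.2.1 (Sum.inl c))
    (congrArg (Prod.mk (x, y)) hu) (fr.differentiableAt_controlField h𝒰 hp)
    (fr.differentiableAt_runningCost h𝒰 hcost hp)
    (hasFDerivAt_const _ _) (statePart n k r).hasFDerivAt hκ hstat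
  have hidentity : (fun v => fr.extendedLagrangian cost
      (x, y, baseMultiplier ξ, constraintMultiplier ξ) v) = _ := funext fun v =>
    fr.extendedLagrangian_eq_runningCost_add ξ x v.1 y v.2.1 v.2.2.1 v.2.2.2
  rw [hidentity]
  refine (HasFDerivAt.fderiv henvelope).trans ?_
  simp

theorem force_snd_controlField (C : Fin k ⊕ Fin r) :
    fr.force x y (fr.controlField ((x, y), u)).2 C = Sum.elim u 0 C := by
  rw [fr.force_eq_add]
  exact sub_add_cancel _ _

theorem fderiv_extendedLagrangian_state_of_stationary (h𝒰 : IsOpen 𝒰)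
    (hcost : fr.SmoothCost 𝒰 cost) (hp : ((x, y), u) ∈ fr.controlDomain 𝒰)
    (hu : (fun c => fr.force x y yd (Sum.inl c)) = u)
    (hstat : (ξ ∘L fderiv ℝ fr.controlField ((x, y), u)
      - fderiv ℝ (fr.runningCost cost) ((x, y), u)) ∘L
        ContinuousLinearMap.inr ℝ (State n k r) (Fin k → ℝ) = 0) (v : State n k r) :
    fderiv ℝ (fun z => fr.extendedLagrangian cost z (xd, yd, ld, lbd))
        (x, y, baseMultiplier ξ, constraintMultiplier ξ) (v.1, v.2, 0)
      = -(ξ ∘L fderiv ℝ fr.controlField ((x, y), u)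
        - fderiv ℝ (fr.runningCost cost) ((x, y), u)) (v, 0) := by
  have hdom : (x, y, yd) ∈ fr.lagrangianDomain 𝒰 :=
    fr.mem_lagrangianDomain_of_mem_controlDomain hp hu
  have hκ : DifferentiableAt ℝ (fun w : State n k r => fun c : Fin k =>
      fr.force w.1 w.2 yd (Sum.inl c)) (x, y) :=
    DifferentiableAt.comp (f := fun w : State n k r => ((w.1, w.2, yd) : Jet n k r)) (x, y)
      ((fr.contDiffOn_actuatedForce.contDiffAt ((fr.chart.open_target.prod isOpen_univ).mem_nhds
        hdom.1)).differentiableAt (by simp)) (by fun_prop)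
  have henvelope := hasFDerivAt_cost_add_defect (σ := id)
    (congrArg (Prod.mk (x, y)) hu) (fr.differentiableAt_controlField h𝒰 hp)
    (fr.differentiableAt_runningCost h𝒰 hcost hp) (hasFDerivAt_id _)
    (hasFDerivAt_const ((xd, yd) : State n k r) _) hκ hstat
  have hinclusion := (hasFDerivAt_fst (p := (x, y))).prodMk ((hasFDerivAt_snd (𝕜 := ℝ)).prodMk
    (hasFDerivAt_const (baseMultiplier ξ, constraintMultiplier ξ) (x, y)))
  have hrestrict := (fr.differentiableAt_extendedLagrangian_position (xd := xd) (ld := ld)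
    (lbd := lbd) (l := baseMultiplier ξ) (lb := constraintMultiplier ξ) h𝒰 hcost
    hdom).hasFDerivAt.comp (x, y) hinclusion
  have hidentity : ((fun z => fr.extendedLagrangian cost z (xd, yd, ld, lbd)) ∘
      fun w : State n k r => (w.1, w.2, baseMultiplier ξ, constraintMultiplier ξ)) = _ :=
    funext fun w => fr.extendedLagrangian_eq_runningCost_add ξ w.1 xd w.2 yd ld lbd
  rw [hidentity] at hrestrict
  refine (congrArg (fun φ => φ v) (hrestrict.unique henvelope)).trans ?_
  simp

theorem fderiv_extendedLagrangian_position_of_stationary (h𝒰 : IsOpen 𝒰)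
    (hcost : fr.SmoothCost 𝒰 cost) (hp : ((x, y), u) ∈ fr.controlDomain 𝒰)
    (hfield : (xd, yd) = fr.controlField ((x, y), u))
    (hstat : (ξ ∘L fderiv ℝ fr.controlField ((x, y), u)
      - fderiv ℝ (fr.runningCost cost) ((x, y), u)) ∘L
        ContinuousLinearMap.inr ℝ (State n k r) (Fin k → ℝ) = 0) :
    fderiv ℝ (fun z => fr.extendedLagrangian cost z (xd, yd, ld, lbd))
        (x, y, baseMultiplier ξ, constraintMultiplier ξ)
      = -((ξ ∘L fderiv ℝ fr.controlField ((x, y), u)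
        - fderiv ℝ (fr.runningCost cost) ((x, y), u)) ∘L
          ContinuousLinearMap.inl ℝ (State n k r) (Fin k → ℝ)) ∘L statePart n k r := by
  obtain ⟨hxd, hyd⟩ := Prod.mk.inj hfield
  have hforce : ∀ C, fr.force x y yd C = Sum.elim u 0 C := hyd ▸ fr.force_snd_controlField
  have hu : (fun c => fr.force x y yd (Sum.inl c)) = u := funext fun c => hforce (Sum.inl c)
  refine ContinuousLinearMap.ext fun e => ?_
  have hsplit : e = (e.1, e.2.1, 0) + (0, 0, e.2.2.1, e.2.2.2) := by simp
  rw [hsplit, map_add, fr.fderiv_extendedLagrangian_state_of_stationary h𝒰 hcost hp hu hstat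
    (e.1, e.2.1), fr.fderiv_extendedLagrangian_multiplier h𝒰 hcost
      (fr.mem_lagrangianDomain_of_mem_controlDomain hp hu)]
  simp [Phi, hforce, hxd, statePart, -Fintype.sum_sum_type]

end AdjointIdentity

section Solutions

variable {fr} {N : ℕ∞} {x : ℝ → EuclideanSpace ℝ (Fin n)} {y : ℝ → Fin k ⊕ Fin r → ℝ}
  {u : ℝ → Fin k → ℝ}

theorem IsSolution.force_eq (h : fr.IsSolution 𝒰 N T x y u) {t : ℝ} (ht : t ∈ Icc 0 T)
    (C : Fin k ⊕ Fin r) :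
    fr.force (x t) (y t) (derivWithin y (Icc 0 T) t) C = Sum.elim (u t) 0 C := by
  refine sub_eq_zero.mp (Fintype.linearIndependent_iff.mp
    (fr.linearIndependent _ (fr.chart.map_target (h.x_mem t ht)))
    (fun C => fr.force (x t) (y t) (derivWithin y (Icc 0 T) t) C - Sum.elim (u t) 0 C) ?_ C)
  simp only [sub_smul, Finset.sum_sub_distrib, h.dynamics t ht]
  simp

theorem IsSolution.mem_controlDomain (h : fr.IsSolution 𝒰 N T x y u) {t : ℝ}
    (ht : t ∈ Icc 0 T) : ((x t, y t), u t) ∈ fr.controlDomain 𝒰 :=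
  ⟨⟨h.x_mem t ht, mem_univ _⟩, h.u_mem t ht⟩

theorem IsSolution.derivWithin_eq (h : fr.IsSolution 𝒰 N T x y u) {t : ℝ} (ht : t ∈ Icc 0 T) :
    (derivWithin x (Icc 0 T) t, derivWithin y (Icc 0 T) t)
      = fr.controlField ((x t, y t), u t) := by
  refine Prod.ext ?_ (funext fun C => ?_)
  · exact (h.admissible t ht).trans (PiLp.ext fun i => fr.anchorCoord_vec (x t) (y t) i)
  · exact eq_sub_of_add_eq ((fr.force_eq_add _ _ _ C).symm.trans (h.force_eq ht C))

theorem IsSolution.isTrajectory (h : fr.IsSolution 𝒰 N T x y u) (hN : 1 ≤ N) :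
    IsTrajectory fr.controlField T (fun t => (x t, y t)) u := fun t ht =>
  have hN' : (N : WithTop ℕ∞) ≠ 0 := mod_cast (zero_lt_one.trans_le hN).ne'
  ((h.x_regular.differentiableOn hN' t ht).hasDerivWithinAt.prodMk
    (h.y_regular.differentiableOn hN' t ht).hasDerivWithinAt).congr_deriv (h.derivWithin_eq ht)

theorem IsSolution.contDiffOn_control (h : fr.IsSolution 𝒰 N T x y u) (hT : 0 < T) {j : ℕ}
    (hj : ((j + 1 : ℕ) : ℕ∞) ≤ N) : ContDiffOn ℝ j u (Icc 0 T) := by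
  have hsucc : ((j : WithTop ℕ∞) + 1) ≤ (N : WithTop ℕ∞) := mod_cast hj
  have hle : (j : WithTop ℕ∞) ≤ (N : WithTop ℕ∞) := le_self_add.trans hsucc
  have hyd : ContDiffOn ℝ j (derivWithin y (Icc 0 T)) (Icc 0 T) :=
    h.y_regular.derivWithin (uniqueDiffOn_Icc hT) hsucc
  exact ((fr.contDiffOn_actuatedForce.of_le (mod_cast le_top)).comp
    ((h.x_regular.of_le hle).prodMk ((h.y_regular.of_le hle).prodMk hyd))
    fun t ht => ⟨h.x_mem t ht, mem_univ _⟩).congr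
    fun t ht => funext fun c => (h.force_eq ht (Sum.inl c)).symm

theorem isSolution_of_isTrajectory (hT : 0 < T) {z : ℝ → State n k r}
    (hu : ∀ j : ℕ, ((j + 1 : ℕ) : ℕ∞) ≤ N → ContDiffOn ℝ j u (Icc 0 T))
    (hmem : ∀ t ∈ Icc 0 T, (z t, u t) ∈ fr.controlDomain 𝒰)
    (hz : IsTrajectory fr.controlField T z u) :
    fr.IsSolution 𝒰 N T (fun t => (z t).1) (fun t => (z t).2) u := by
  have hregular := hz.contDiffOn hT fr.contDiffOn_controlField hu hmem
  have hunique := uniqueDiffOn_Icc hT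
  refine ⟨contDiff_fst.comp_contDiffOn hregular, contDiff_snd.comp_contDiffOn hregular,
    fun t ht => (hmem t ht).1.1, fun t ht => (hmem t ht).2, fun t ht => ?_, fun t ht => ?_⟩
  · have hderiv : HasDerivWithinAt (fun t => (z t).1) (fr.controlField (z t, u t)).1 (Icc 0 T) t :=
      by simpa using (hz t ht).hasFDerivWithinAt.fst.hasDerivWithinAt
    rw [hderiv.derivWithin (hunique t ht)]
    exact PiLp.ext fun i => (fr.anchorCoord_vec (z t).1 (z t).2 i).symm
  · have hderiv : HasDerivWithinAt (fun t => (z t).2) (fr.controlField (z t, u t)).2 (Icc 0 T) t :=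
      by simpa using (hz t ht).hasFDerivWithinAt.snd.hasDerivWithinAt
    simp [hderiv.derivWithin (hunique t ht),
      fr.force_snd_controlField (x := (z t).1) (y := (z t).2)]

theorem IsLocallyOptimal.isLocallyOptimalControl (hT : 0 < T)
    (hopt : fr.IsLocallyOptimal 𝒰 cost N T x y u) :
    IsLocallyOptimalControl (fr.controlDomain 𝒰) fr.controlField (fr.runningCost cost) T
      (fun t => (x t, y t)) u := by
  obtain ⟨h, ε, hε, hext⟩ := hopt
  have hcompetitor {z' : ℝ → State n k r} {v : ℝ → Fin k → ℝ}
      (hv : IsControlVariation (fr.controlDomain 𝒰) fr.controlField T ε (fun t => (x t, y t)) u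
        z' v) :
      fr.IsCompetitor 𝒰 N T ε x y u (fun t => (z' t).1) (fun t => (z' t).2) (u + v) := by
    refine ⟨isSolution_of_isTrajectory hT (fun j hj => ?_) hv.mem hv.isTrajectory,
      congrArg Prod.fst hv.left_eq, congrArg Prod.snd hv.left_eq, congrArg Prod.fst hv.right_eq,
      congrArg Prod.snd hv.right_eq, fun t ht => ?_⟩
    · exact (h.contDiffOn_control hT hj).add (hv.contDiff.of_le (mod_cast le_top)).contDiffOn
    · obtain ⟨hz, hvt⟩ := hv.close t ht
      exact ⟨(norm_fst_le (z' t - (x t, y t))).trans_lt hz,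
        (norm_snd_le (z' t - (x t, y t))).trans_lt hz, by simpa using hvt⟩
  exact ⟨ε, hε, hext.imp (fun hmin z' v hv => hmin _ _ _ (hcompetitor hv))
    fun hmax z' v hv => hmax _ _ _ (hcompetitor hv)⟩

theorem contDiffOn_adjointCurve (h𝒰 : IsOpen 𝒰) (hcost : fr.SmoothCost 𝒰 cost)
    (hT : 0 < T) (hN : 1 ≤ N) (h : fr.IsSolution 𝒰 N T x y u) {ξ : ℝ → State n k r →L[ℝ] ℝ}
    (hξ : IsAdjointCurve (fun t => fderiv ℝ fr.controlField ((x t, y t), u t))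
      (-fun t => fderiv ℝ (fr.runningCost cost) ((x t, y t), u t)) T ξ) :
    ContDiffOn ℝ 1 ξ (Icc 0 T) := by
  have hΩ := fr.isOpen_controlDomain h𝒰
  have hmem : MapsTo (fun t => ((x t, y t), u t)) (Icc 0 T) (fr.controlDomain 𝒰) :=
    fun t ht => h.mem_controlDomain ht
  have hcurve : ContinuousOn (fun t => ((x t, y t), u t)) (Icc 0 T) :=
    (h.x_regular.continuousOn.prodMk h.y_regular.continuousOn).prodMk
      (h.contDiffOn_control (j := 0) hT (by simpa using hN)).continuousOn
  exact hξ.contDiffOn hT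
    ((fr.contDiffOn_controlField.continuousOn_fderiv_of_isOpen hΩ (by simp)).comp hcurve hmem)
    (((fr.contDiffOn_runningCost hcost).continuousOn_fderiv_of_isOpen hΩ
      (by simp)).comp hcurve hmem).neg

theorem necessaryConditions_of_isAdjointCurve (h𝒰 : IsOpen 𝒰) (hcost : fr.SmoothCost 𝒰 cost)
    (hT : 0 < T) (hN : 1 ≤ N) (h : fr.IsSolution 𝒰 N T x y u) {ξ : ℝ → State n k r →L[ℝ] ℝ}
    (hξ : IsAdjointCurve (fun t => fderiv ℝ fr.controlField ((x t, y t), u t))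
      (-fun t => fderiv ℝ (fr.runningCost cost) ((x t, y t), u t)) T ξ) :
    fr.NecessaryConditions (fr.lagrangian cost) T x y (fun t => baseMultiplier (ξ t))
      (fun t => constraintMultiplier (ξ t)) := by
  have hx := h.x_regular.of_le (mod_cast hN : (1 : WithTop ℕ∞) ≤ N)
  have hy := h.y_regular.of_le (mod_cast hN : (1 : WithTop ℕ∞) ≤ N)
  have hξ_regular := contDiffOn_adjointCurve h𝒰 hcost hT hN h hξ
  have hl : ContDiffOn ℝ 1 (fun t => baseMultiplier (ξ t)) (Icc 0 T) :=
    contDiffOn_pi.mpr fun i => hξ_regular.clm_apply contDiffOn_const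
  have hlb : ContDiffOn ℝ 1 (fun t => constraintMultiplier (ξ t)) (Icc 0 T) :=
    contDiffOn_pi.mpr fun α => hξ_regular.clm_apply contDiffOn_const
  have hmem := fun t (ht : t ∈ Icc 0 T) => h.mem_controlDomain ht
  have hu := fun t (ht : t ∈ Icc 0 T) => funext fun c => h.force_eq ht (Sum.inl c)
  have hstat := hξ.stationary
  simp only [Pi.neg_apply, ← sub_eq_add_neg] at hstat
  rw [fr.necessaryConditions_iff_eulerLagrange h𝒰 hcost hT hx hy hl hlb fun t ht =>
    fr.mem_lagrangianDomain_of_mem_controlDomain (hmem t ht) (hu t ht)]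
  intro t ht
  have hmomentum : HasDerivWithinAt (fun s => ξ s ∘L statePart n k r) _ (Icc 0 T) t :=
    (hξ.hasDerivWithinAt t ht).clm_comp (hasDerivWithinAt_const t _ (statePart n k r))
  rw [derivWithin_extended hT hx hy hl hlb ht, fr.fderiv_extendedLagrangian_position_of_stationary
    h𝒰 hcost (hmem t ht) (h.derivWithin_eq ht) (hstat t ht)]
  refine (hmomentum.congr_of_mem (fun s hs => ?_) ht).congr_deriv ?_
  · rw [derivWithin_extended hT hx hy hl hlb hs]
    exact fr.fderiv_extendedLagrangian_velocity_of_stationary h𝒰 hcost (hmem s hs) (hu s hs)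
      (hstat s hs)
  · simp [sub_eq_add_neg]

theorem isAbnormal_of_isAdjointCurve (h𝒰 : IsOpen 𝒰) (hT : 0 < T) (hN : 1 ≤ N)
    (h : fr.IsSolution 𝒰 N T x y u) {ξ : ℝ → State n k r →L[ℝ] ℝ}
    (hξ : IsAdjointCurve (fun t => fderiv ℝ fr.controlField ((x t, y t), u t)) 0 T ξ)
    (hξT : ξ T ≠ 0) : fr.IsAbnormal T x y := by
  have hTmem : T ∈ Icc 0 T := ⟨hT.le, le_rfl⟩
  have hnull : fr.SmoothCost 𝒰 (fun _ _ _ => 0) := contDiffOn_const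
  have hnull_deriv : (-fun t => fderiv ℝ (fr.runningCost (fun _ _ _ => 0)) ((x t, y t), u t))
      = 0 := funext fun t => by
    change -fderiv ℝ (fun _ => (0 : ℝ)) ((x t, y t), u t) = 0
    simp
  refine ⟨_, _, necessaryConditions_of_isAdjointCurve h𝒰 hnull hT hN h (hnull_deriv ▸ hξ), T,
    hTmem, ?_⟩
  by_contra! hzero
  have hactuated (a : Fin k) : ξ T (0, Pi.single (Sum.inl a) 1) = 0 := by
    have hstat := congrArg (fun φ => φ (Pi.single a 1)) (hξ.stationary T hTmem)
    simpa [fr.fderiv_controlField_control h𝒰 (h.mem_controlDomain hTmem)] using hstat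
  refine hξT (ContinuousLinearMap.ext fun v => ?_)
  rw [covector_apply_eq_sum]
  simp [hactuated, hzero.1, hzero.2]

theorem exists_necessaryConditions_of_isLocallyOptimal (h𝒰 : IsOpen 𝒰)
    (hcost : fr.SmoothCost 𝒰 cost) (hT : 0 < T) (hN : 1 ≤ N)
    (hopt : fr.IsLocallyOptimal 𝒰 cost N T x y u) (habn : ¬ fr.IsAbnormal T x y) :
    ∃ (lam : ℝ → Fin n → ℝ) (lamBar : ℝ → Fin r → ℝ),
      fr.NecessaryConditions (fr.lagrangian cost) T x y lam lamBar := by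
  have h := hopt.1
  obtain ⟨p₀, ξ, hne, hξ⟩ := exists_isAdjointCurve_of_isLocallyOptimalControl hT
    (fr.isOpen_controlDomain h𝒰) (fr.contDiffOn_controlField.of_le (by simp))
    ((fr.contDiffOn_runningCost hcost).of_le (by simp))
    (h.contDiffOn_control (j := 0) hT (by simpa using hN)).continuousOn
    (fun t ht => h.mem_controlDomain ht) (h.isTrajectory hN) (hopt.isLocallyOptimalControl hT)
  rcases eq_or_ne p₀ 0 with rfl | hp₀
  · rw [zero_smul] at hξ
    exact absurd (isAbnormal_of_isAdjointCurve h𝒰 hT hN h hξ (hne.resolve_left (· rfl))) habn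
  · exact ⟨_, _, necessaryConditions_of_isAdjointCurve h𝒰 hcost hT hN h
      ((hξ.const_smul (-p₀⁻¹)).congr (fun _ _ => rfl) fun t _ =>
        ContinuousLinearMap.ext fun v => by simp [hp₀])⟩

end Solutions

end AdaptedFrame

end NonholonomicControl

end

theorem mainTheorem2_general {n m k r : ℕ}
    {Q : Type*} [TopologicalSpace Q] [ChartedSpace (EuclideanSpace ℝ (Fin n)) Q]
    [IsManifold (𝓡 n) ∞ Q]
    {F : Type*} [NormedAddCommGroup F] [NormedSpace ℝ F]
    {E : Q → Type*} [TopologicalSpace (TotalSpace F E)] [∀ q, TopologicalSpace (E q)]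
    [FiberBundle F E] [∀ q, AddCommGroup (E q)] [∀ q, Module ℝ (E q)] [VectorBundle ℝ F E]
    (𝒜 : NonholonomicControl.LieAlgebroid n F E)
    (S : NonholonomicControl.NonholonomicSystem 𝒜 m)
    (Dc : ∀ q : Q, Submodule ℝ (E q))
    (fr : NonholonomicControl.AdaptedFrame S Dc k r)
    (𝒰 : Set (Fin k → ℝ)) (h𝒰 : IsOpen 𝒰)
    (cost : (q : Q) → S.D q → (Fin k → ℝ) → ℝ) (hcost : fr.SmoothCost 𝒰 cost)
    (T : ℝ) (hT : 0 < T) :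
    (∀ (N : ℕ∞), 1 ≤ N →
      ∀ (x : ℝ → EuclideanSpace ℝ (Fin n)) (y : ℝ → Fin k ⊕ Fin r → ℝ) (u : ℝ → Fin k → ℝ),
        fr.IsLocallyOptimal 𝒰 cost N T x y u → ¬ fr.IsAbnormal T x y →
          ∃ (lam : ℝ → Fin n → ℝ) (lamBar : ℝ → Fin r → ℝ),
            fr.NecessaryConditions (fr.lagrangian cost) T x y lam lamBar) ∧
    (∀ (x : ℝ → EuclideanSpace ℝ (Fin n)) (y : ℝ → Fin k ⊕ Fin r → ℝ)
      (lam : ℝ → Fin n → ℝ) (lamBar : ℝ → Fin r → ℝ),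
        ContDiffOn ℝ 1 x (Set.Icc 0 T) → ContDiffOn ℝ 1 y (Set.Icc 0 T) →
        ContDiffOn ℝ 1 lam (Set.Icc 0 T) → ContDiffOn ℝ 1 lamBar (Set.Icc 0 T) →
        (∀ t ∈ Set.Icc 0 T, x t ∈ fr.chart.target ∧
          (fun c => fr.force (x t) (y t) (derivWithin y (Set.Icc 0 T) t) (Sum.inl c)) ∈ 𝒰) →
        (fr.NecessaryConditions (fr.lagrangian cost) T x y lam lamBar ↔
          NonholonomicControl.EulerLagrange (fr.extendedLagrangian cost) T
            (fun t => (x t, y t, lam t, lamBar t))) ∧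
        (fr.NecessaryConditions (fr.lagrangian cost) T x y lam lamBar ↔
          NonholonomicControl.IsStationary (fr.extendedLagrangian cost) T
            (fun t => (x t, y t, lam t, lamBar t)))) := by
  refine ⟨fun N hN x y u hopt habn =>
    NonholonomicControl.AdaptedFrame.exists_necessaryConditions_of_isLocallyOptimal h𝒰 hcost hT hN
      hopt habn, fun x y lam lamBar hx hy hl hlb hmem => ?_⟩
  have hdom : ∀ t ∈ Set.Icc 0 T,
      (x t, y t, derivWithin y (Set.Icc 0 T) t) ∈ fr.lagrangianDomain 𝒰 := fun t ht =>
    ⟨⟨(hmem t ht).1, Set.mem_univ _⟩, (hmem t ht).2⟩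
  exact ⟨fr.necessaryConditions_iff_eulerLagrange h𝒰 hcost hT hx hy hl hlb hdom,
    fr.necessaryConditions_iff_isStationary h𝒰 hcost hT hx hy hl hlb hdom⟩

theorem mainTheorem2 {n k r : ℕ}
    {Q : Type*} [TopologicalSpace Q] [ChartedSpace (EuclideanSpace ℝ (Fin n)) Q]
    [IsManifold (𝓡 n) ∞ Q] [T2Space Q] [SecondCountableTopology Q]
    {F : Type*} [NormedAddCommGroup F] [NormedSpace ℝ F] [FiniteDimensional ℝ F]
    {E : Q → Type*} [TopologicalSpace (TotalSpace F E)] [∀ q, TopologicalSpace (E q)]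
    [FiberBundle F E] [∀ q, AddCommGroup (E q)] [∀ q, Module ℝ (E q)] [VectorBundle ℝ F E]
    [ContMDiffVectorBundle ∞ F E (𝓡 n)]
    (𝒜 : NonholonomicControl.LieAlgebroid n F E)
    (S : NonholonomicControl.NonholonomicSystem 𝒜 (k + r))
    (Dc : ∀ q : Q, Submodule ℝ (E q)) (hDc : NonholonomicControl.IsSubbundle n F Dc k)
    (hk : k < k + r)
    (fr : NonholonomicControl.AdaptedFrame S Dc k r)
    (𝒰 : Set (Fin k → ℝ)) (h𝒰 : IsOpen 𝒰)
    (cost : (q : Q) → S.D q → (Fin k → ℝ) → ℝ) (hcost : fr.SmoothCost 𝒰 cost)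
    (T : ℝ) (hT : 0 < T) :
    -- every local optimum is abnormal or satisfies the system with suitable multipliers
    (∀ (N : ℕ∞), 1 ≤ N →
      ∀ (x : ℝ → EuclideanSpace ℝ (Fin n)) (y : ℝ → Fin k ⊕ Fin r → ℝ) (u : ℝ → Fin k → ℝ),
        fr.IsLocallyOptimal 𝒰 cost N T x y u → ¬ fr.IsAbnormal T x y →
          ∃ (lam : ℝ → Fin n → ℝ) (lamBar : ℝ → Fin r → ℝ),
            fr.NecessaryConditions (fr.lagrangian cost) T x y lam lamBar) ∧
    -- the system is the Euler-Lagrange system of the constrained variational problem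
    (∀ (x : ℝ → EuclideanSpace ℝ (Fin n)) (y : ℝ → Fin k ⊕ Fin r → ℝ)
      (lam : ℝ → Fin n → ℝ) (lamBar : ℝ → Fin r → ℝ),
        ContDiffOn ℝ 1 x (Set.Icc 0 T) → ContDiffOn ℝ 1 y (Set.Icc 0 T) →
        ContDiffOn ℝ 1 lam (Set.Icc 0 T) → ContDiffOn ℝ 1 lamBar (Set.Icc 0 T) →
        (∀ t ∈ Set.Icc 0 T, x t ∈ fr.chart.target ∧
          (fun c => fr.force (x t) (y t) (derivWithin y (Set.Icc 0 T) t) (Sum.inl c)) ∈ 𝒰) →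
        (fr.NecessaryConditions (fr.lagrangian cost) T x y lam lamBar ↔
          NonholonomicControl.EulerLagrange (fr.extendedLagrangian cost) T
            (fun t => (x t, y t, lam t, lamBar t))) ∧
        (fr.NecessaryConditions (fr.lagrangian cost) T x y lam lamBar ↔
          NonholonomicControl.IsStationary (fr.extendedLagrangian cost) T
            (fun t => (x t, y t, lam t, lamBar t)))) :=
  mainTheorem2_general 𝒜 S Dc fr 𝒰 h𝒰 cost hcost T hT
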